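/- Let $n \ge 1$ and let $X$ be a compact connected (Hausdorff) complex manifold of complex dimension $2n$, equipped with a complex symplectic form $\sigma$, i.e. a smooth $d$-closed $(2,0)$-form which is non-degenerate at every point. For $p,q\ge 0$ let $\mathcal A^{p,q}(X)$ be the space of smooth complex-valued $(p,q)$-forms on $X$ and let $$H^{p,q}_{\bar\partial}(X)=\frac{\ker(\bar\partial:\mathcal A^{p,q}(X)\to\mathcal A^{p,q+1}(X))}{\operatorname{im}(\bar\partial:\mathcal A^{p,q-1}(X)\to\mathcal A^{p,q}(X))}$$ be the Dolbeault cohomology of $X$ (with $\mathcal A^{p,-1}(X)=0$). Then for every $q \ge 0$ and every $\bar\partial$-closed $\alpha\in\mathcal A^{1,q}(X)$ the form $\sigma^{n-1}\wedge\alpha\in\mathcal A^{2n-1,q}(X)$ is $\bar\partial$-closed, and the map $$L_\sigma^{n-1}: H^{1,q}_{\bar\partial}(X)\longrightarrow H^{2n-1,q}_{\bar\partial}(X),\qquad [\alpha]\longmapsto[\sigma^{n-1}\wedge\alpha]$$ is well defined and is an isomorphism of complex vector spaces. -/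

import Mathlib

open scoped ContDiff Manifold ComplexConjugate

noncomputable section

namespace ComplexForms

section Linear

variable {E : Type*} [NormedAddCommGroup E] [NormedSpace ℂ E]

/-- The wedge product of complex-valued real-multilinear alternating forms, with the convention
`(a ∧ b)(v₁, …, vₖ₊ₗ) = ∑ sign(s) a(v_{s 1}, …, v_{s k}) b(v_{s (k+1)}, …, v_{s (k+l)})`,
the sum running over the `(k,l)`-shuffles `s`. -/
def wedge {k l : ℕ} (a : E [⋀^Fin k]→L[ℝ] ℂ) (b : E [⋀^Fin l]→L[ℝ] ℂ) :
    E [⋀^Fin (k + l)]→L[ℝ] ℂ :=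
  let w : E [⋀^Fin (k + l)]→ₗ[ℝ] ℂ :=
    ((LinearMap.mul' ℝ ℂ).compAlternatingMap
      (a.toAlternatingMap.domCoprod b.toAlternatingMap)).domDomCongr finSumFinEquiv
  { w with
    cont := by
      change Continuous fun v => w v
      have hw : ∀ v, w v = ∑ s : Equiv.Perm.ModSumCongr (Fin k) (Fin l),
          LinearMap.mul' ℝ ℂ (AlternatingMap.domCoprod.summand a.toAlternatingMap
            b.toAlternatingMap s (v ∘ finSumFinEquiv)) := fun v => by
        simp [w, AlternatingMap.domCoprod_apply, Function.comp_def]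
      simp only [hw]
      refine continuous_finsetSum _ fun s _ => ?_
      induction s using Quotient.inductionOn' with
      | h s =>
        have hs : ∀ v : Fin (k + l) → E, LinearMap.mul' ℝ ℂ (AlternatingMap.domCoprod.summand
            a.toAlternatingMap b.toAlternatingMap (Quotient.mk'' s) (v ∘ finSumFinEquiv)) =
            Equiv.Perm.sign s • (a (fun i => v (finSumFinEquiv (s (Sum.inl i)))) *
              b (fun i => v (finSumFinEquiv (s (Sum.inr i))))) := fun v => by
          rw [AlternatingMap.domCoprod.summand_mk'']
          simp only [smul_apply, MultilinearMap.domDomCongr_apply,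
            MultilinearMap.domCoprod_apply, map_zsmul_unit, LinearMap.mul'_apply]
          rfl
        simp only [hs]
        refine Continuous.const_smul (Continuous.mul ?_ ?_) _
        · exact a.cont.comp (by fun_prop)
        · exact b.cont.comp (by fun_prop) }

/-- The `m`-th wedge power of a `2`-form. -/
def wedgePow (s : E [⋀^Fin 2]→L[ℝ] ℂ) :
    (m : ℕ) → E [⋀^Fin (2 * m)]→L[ℝ] ℂ
  | 0 => ContinuousAlternatingMap.constOfIsEmpty ℝ E (Fin 0) 1
  | m + 1 => wedge (wedgePow s m) s

/-- A `k`-form regarded as an `l`-form, where `k = l`. -/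
def castDeg {k l : ℕ} (h : k = l) (a : E [⋀^Fin k]→L[ℝ] ℂ) : E [⋀^Fin l]→L[ℝ] ℂ :=
  { ContinuousMultilinearMap.domDomCongr (finCongr h) a.toContinuousMultilinearMap,
    AlternatingMap.domDomCongr (finCongr h) a.toAlternatingMap with }

/-- The forms of type `(p, q)` on the complex vector space `E`: those complex-valued
real-multilinear alternating `(p+q)`-forms `η` with `η (c v₁, …, c vₖ) = cᵖ c̄^q η (v₁, …, vₖ)` for
all complex numbers `c`. As `dz_I ∧ dz̄_J` with `|I| = a`, `|J| = b` is multiplied by `cᵃ c̄ᵇ`, these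
are exactly the combinations of the `dz_I ∧ dz̄_J` with `|I| = p`, `|J| = q`. -/
def HasType (p q : ℕ) (η : E [⋀^Fin (p + q)]→L[ℝ] ℂ) : Prop :=
  ∀ (c : ℂ) (v : Fin (p + q) → E), η (fun i => c • v i) = c ^ p * conj c ^ q * η v

/-- The complex-antilinear part `u ↦ (D u + i D (i u)) / 2` of a real-linear map `D`. Applied to the
derivative of `f`, it is `u ↦ ∑ⱼ ∂f/∂z̄ⱼ dz̄ⱼ(u)`. -/
def antilinearPart {F : Type*} [NormedAddCommGroup F] [NormedSpace ℂ F] (D : E →L[ℝ] F) :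
    E →L[ℝ] F :=
  (1 / 2 : ℂ) • (D + Complex.I • D.comp ((Complex.I • ContinuousLinearMap.id ℂ E).restrictScalars ℝ))

theorem antilinearPart_add {F : Type*} [NormedAddCommGroup F] [NormedSpace ℂ F]
    (D D' : E →L[ℝ] F) : antilinearPart (D + D') = antilinearPart D + antilinearPart D' := by
  ext u
  simp [antilinearPart, smul_add]
  abel

theorem antilinearPart_smul {F : Type*} [NormedAddCommGroup F] [NormedSpace ℂ F]
    (c : ℂ) (D : E →L[ℝ] F) : antilinearPart (c • D) = c • antilinearPart D := by
  ext u
  simp only [antilinearPart, smul_add, ContinuousLinearMap.smul_comp,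
    add_apply, smul_apply]
  rw [smul_comm _ c, smul_comm Complex.I c, smul_comm _ c]

/-- The operator `∂̄` on complex-valued forms on (an open set of) the complex vector space `E`:
`∂̄ (∑ f_{IJ} dz_I ∧ dz̄_J) = ∑ ∂f_{IJ}/∂z̄ⱼ dz̄ⱼ ∧ dz_I ∧ dz̄_J`. It is Mathlib's exterior derivative
`extDeriv` with the derivative of the form replaced by its antilinear part. -/
def dbarFlat {k : ℕ} (w : E → E [⋀^Fin k]→L[ℝ] ℂ) (y : E) : E [⋀^Fin (k + 1)]→L[ℝ] ℂ :=
  .alternatizeUncurryFin (antilinearPart (fderiv ℝ w y))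

end Linear

section Manifold

variable (E : Type*) [NormedAddCommGroup E] [NormedSpace ℂ E]
variable (X : Type*)

/-- Complex-valued differential `k`-forms, with no regularity, on a complex manifold `X`
modelled on `E`. The
tangent space of `X` at `x` is `E`, which is what `TangentSpace 𝓘(ℂ, E) x` unfolds to: a tangent
vector at `x` is given by its coordinates in the preferred chart at `x`. -/
def DForm (k : ℕ) : Type _ := X → E [⋀^Fin k]→L[ℝ] ℂ

instance (k : ℕ) : AddCommGroup (DForm E X k) :=
  inferInstanceAs (AddCommGroup (X → E [⋀^Fin k]→L[ℝ] ℂ))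

instance (k : ℕ) : Module ℂ (DForm E X k) :=
  inferInstanceAs (Module ℂ (X → E [⋀^Fin k]→L[ℝ] ℂ))

variable {E X}

@[simp]
theorem DForm.zero_apply {k : ℕ} (x : X) : (0 : DForm E X k) x = 0 := rfl

@[simp]
theorem DForm.add_apply {k : ℕ} (α β : DForm E X k) (x : X) : (α + β) x = α x + β x := rfl

@[simp]
theorem DForm.smul_apply {k : ℕ} (c : ℂ) (α : DForm E X k) (x : X) : (c • α) x = c • α x := rfl

variable [TopologicalSpace X] [ChartedSpace E X] [IsManifold 𝓘(ℂ, E) ω X]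

/-- The expression of a form in the preferred chart `φ` at `x₀`, i.e. its pull-back to the open set
`φ.target` of `E` by `φ⁻¹`. At `y = φ x`, a vector given in the chart `φ` is first converted
to the preferred chart at `x`. (Junk off `φ.target`.) -/
def chartRep {k : ℕ} (α : DForm E X k) (x₀ : X) (y : E) : E [⋀^Fin k]→L[ℝ] ℂ :=
  let x : X := (chartAt E x₀).symm y
  (α x).compContinuousLinearMap ((tangentCoordChange 𝓘(ℂ, E) x₀ x x).restrictScalars ℝ)

/-- Smoothness of a form: its expressions in charts are smooth (in the real sense). -/
def IsSmooth {k : ℕ} (α : DForm E X k) : Prop :=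
  ∀ x₀ : X, ContDiffOn ℝ ∞ (chartRep α x₀) (chartAt E x₀).target

/-- The exterior derivative of a (smooth) form. -/
def extD {k : ℕ} (α : DForm E X k) : DForm E X (k + 1) :=
  fun x => extDeriv (chartRep α x) (chartAt E x x)

/-- The operator `∂̄` on (smooth) forms. -/
def dbar {k : ℕ} (α : DForm E X k) : DForm E X (k + 1) :=
  fun x => dbarFlat (chartRep α x) (chartAt E x x)

theorem chartRep_add {k : ℕ} (α β : DForm E X k) (x₀ : X) :
    chartRep (α + β) x₀ = chartRep α x₀ + chartRep β x₀ := rfl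

theorem chartRep_smul {k : ℕ} (c : ℂ) (α : DForm E X k) (x₀ : X) :
    chartRep (c • α) x₀ = c • chartRep α x₀ := rfl

theorem IsSmooth.differentiableAt {k : ℕ} {α : DForm E X k} (h : IsSmooth α) (x : X) :
    DifferentiableAt ℝ (chartRep α x) (chartAt E x x) :=
  ((h x).contDiffAt ((chartAt E x).open_target.mem_nhds (mem_chart_target E x))).differentiableAt
    (by simp)

theorem dbar_add {k : ℕ} {α β : DForm E X k} (hα : IsSmooth α) (hβ : IsSmooth β) :
    dbar (α + β) = dbar α + dbar β := by
  funext x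
  simp only [dbar, dbarFlat, DForm.add_apply, chartRep_add]
  rw [fderiv_add (hα.differentiableAt x) (hβ.differentiableAt x), antilinearPart_add,
    ContinuousAlternatingMap.alternatizeUncurryFin_add]

theorem dbar_smul {k : ℕ} (c : ℂ) {α : DForm E X k} (hα : IsSmooth α) :
    dbar (c • α) = c • dbar α := by
  funext x
  simp only [dbar, dbarFlat, DForm.smul_apply, chartRep_smul]
  rw [fderiv_const_smul (hα.differentiableAt x), antilinearPart_smul]
  ext v
  simp [ContinuousAlternatingMap.alternatizeUncurryFin_apply, Finset.mul_sum]

variable (E X)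

/-- The space `𝒜^{p,q}(X)` of smooth `(p, q)`-forms. -/
def smoothForms (p q : ℕ) : Submodule ℂ (DForm E X (p + q)) where
  carrier := {α | IsSmooth α ∧ ∀ x, HasType p q (α x)}
  zero_mem' := ⟨fun _ => contDiffOn_const (c := 0), fun _ _ _ => by simp⟩
  add_mem' {α β} hα hβ := ⟨fun x₀ => (hα.1 x₀).add (hβ.1 x₀), fun x c v => by
    simp [hα.2 x c v, hβ.2 x c v, mul_add]⟩
  smul_mem' a {α} hα := ⟨fun x₀ => (hα.1 x₀).const_smul a, fun x c v => by
    simp [hα.2 x c v, mul_left_comm]⟩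

/-- `∂̄` on `𝒜^{p,q}(X)` as a linear map. -/
def dbarLinear (p q : ℕ) : smoothForms E X p q →ₗ[ℂ] DForm E X (p + (q + 1)) where
  toFun α := dbar α.1
  map_add' α β := dbar_add α.2.1 β.2.1
  map_smul' c α := dbar_smul c α.2.1

/-- The space of `∂̄`-closed smooth `(p, q)`-forms. -/
def dbarClosed (p q : ℕ) : Submodule ℂ (DForm E X (p + q)) :=
  (LinearMap.ker (dbarLinear E X p q)).map (smoothForms E X p q).subtype

/-- The space `∂̄ 𝒜^{p,q-1}(X)` of `∂̄`-exact forms in degree `(p, q)`; it is zero if `q = 0`. -/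
def dbarExact (p : ℕ) : (q : ℕ) → Submodule ℂ (DForm E X (p + q))
  | 0 => ⊥
  | q + 1 => LinearMap.range (dbarLinear E X p q)

/-- The Dolbeault cohomology `H^{p,q}_{∂̄}(X)`: the `∂̄`-closed smooth `(p, q)`-forms modulo the
`∂̄`-exact ones. (As `∂̄ ∘ ∂̄ = 0`, exact forms are closed; `submoduleOf` only regards them as a
subspace of the closed ones.) -/
abbrev Dolbeault (p q : ℕ) : Type _ :=
  dbarClosed E X p q ⧸ (dbarExact E X p q).submoduleOf (dbarClosed E X p q)

variable {E X}

/-- The Dolbeault class of a `∂̄`-closed form. -/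
def dolbeaultClass {p q : ℕ} (α : dbarClosed E X p q) : Dolbeault E X p q :=
  Submodule.Quotient.mk α

/-- A complex symplectic form: a smooth `d`-closed `(2, 0)`-form, non-degenerate at every point. -/
structure IsComplexSymplectic (σ : DForm E X 2) : Prop where
  mem_smoothForms : σ ∈ smoothForms E X 2 0
  closed : extD σ = 0
  nondegenerate : ∀ (x : X) (u : E), (∀ v : E, σ x ![u, v] = 0) → u = 0

/-- The form `σᵐ ∧ α`, for a `2`-form `σ`, a `k`-form `α` and `l = 2m + k`. -/
def wedgePowMul (σ : DForm E X 2) (m : ℕ) {k l : ℕ} (h : 2 * m + k = l)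
    (α : DForm E X k) : DForm E X l :=
  fun x => castDeg h (wedge (wedgePow (σ x) m) (α x))

end Manifold

end ComplexForms

end

/-! The map is an isomorphism already before passing to cohomology. Wedging with `σ ^ (n - 1)` is
bijective from smooth `(1, q)`-forms to smooth `(2n-1, q)`-forms for every `q`, and it commutes with
`∂̄`. It is therefore an isomorphism of Dolbeault complexes.

Pointwise bijectivity is `sl₂` theory in the holomorphic directions only. Let `L` be the wedge with
`σ = ½ ∑ sᵢⱼ dzᵢ ∧ dzⱼ`, let `K` be the contraction with the bivector of the inverse matrix, and let
`N` be the operator equal to `p` on type `(p, q)`. The anticommutation relations between `dzᵢ ∧` and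
contraction with the `(1,0)`-part of `eᵢ` give `[K, L] = n - N` (`IsCAR.quad_commutator`), while `L`
and `K` shift `N` by `2` and `-2`. The spectrum of `N` lies in `{0, …, 2n}`, so `K` kills type `(1,
q)` and `L` kills type `(2n-1, q)`. Hence `K^m L^m` on the former and `L^m K^m` on the latter are
the same scalar `lefschetzConst n m`, nonzero for `m = n - 1`. The operators act on `Tot E`, the
product over all degrees, where a `k`-form `η` enters as `Pi.single k η`; they thus lie in one ring
and degree casts disappear. Being of type `(p, q)` becomes an eigenvalue equation for `N`
(`hasType_iff`).

The inverse `K^m`, up to a scalar, has smooth coefficients by Cramer's rule, so smooth forms have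
smooth preimages. For `∂̄`, the `(2,1)`-part of `dσ = 0` gives `∂̄σ = 0`, and the Leibniz rule with
`σ` of even degree gives `∂̄(σ^m ∧ α) = σ^m ∧ ∂̄α` (`IsComplexSymplectic.dbar_wedgePowMul`). -/

noncomputable section

namespace ComplexForms

/-! ### Splitting signed sums over permutations -/

section Permutations

open Equiv

/-- A permutation of `Fin (k + 1)` is determined by its value at `0` and the permutation of
`Fin k` it induces on the remaining indices. -/
theorem sum_perm_fin_succ {k : ℕ} {A : Type*} [AddCommGroup A]
    (F : (Fin (k + 1) → Fin (k + 1)) → A) :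
    ∑ s : Perm (Fin (k + 1)), Perm.sign s • F s =
      ∑ i : Fin (k + 1), (-1) ^ (i : ℕ) • ∑ t : Perm (Fin k),
        Perm.sign t • F (Fin.cons i (fun j => i.succAbove (t j))) := by
  simp only [Finset.smul_sum]
  rw [← Fintype.sum_prod_type' (f := fun (i : Fin (k + 1)) (t : Perm (Fin k)) =>
    (-1) ^ (i : ℕ) • Perm.sign t • F (Fin.cons i (fun j => i.succAbove (t j))))]
  symm
  -- Extend `t` by fixing `0`, then apply the inverse cycle, of sign `(-1)^i`, which sends `0` to
  -- `i` and `j.succ` to `i.succAbove j`.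
  let g : Fin (k + 1) × Perm (Fin k) → Perm (Fin (k + 1)) := fun p =>
    p.1.cycleRange.symm * Perm.decomposeFin.symm (0, p.2)
  have hg : ∀ p : Fin (k + 1) × Perm (Fin k),
      (g p : Fin (k + 1) → Fin (k + 1)) = Fin.cons p.1 (fun j => p.1.succAbove (p.2 j)) := by
    intro p
    funext j
    refine Fin.cases ?_ (fun j => ?_) j
    · simp [g]
    · simp [g]
  have hinj : Function.Injective g := by
    rintro ⟨i, t⟩ ⟨i', t'⟩ h
    have h1 : (Fin.cons i (fun j => i.succAbove (t j)) : Fin (k + 1) → Fin (k + 1)) =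
        Fin.cons i' (fun j => i'.succAbove (t' j)) := by
      rw [← hg (i, t), ← hg (i', t'), h]
    obtain ⟨h2, h3⟩ := Fin.cons_inj.1 h1
    subst h2
    refine Prod.ext rfl (Equiv.ext fun j => ?_)
    exact Fin.succAbove_right_injective (congrFun h3 j)
  refine Fintype.sum_bijective g ?_ _ _ fun p => ?_
  · refine (Fintype.bijective_iff_injective_and_card g).2 ⟨hinj, ?_⟩
    simp [Fintype.card_perm, Nat.factorial_succ]
  · have hs : Perm.sign (g p) = (-1) ^ (p.1 : ℕ) * Perm.sign p.2 := by
      simp [g, Perm.decomposeFin.symm_sign]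
    rw [hg, hs, mul_smul]
    simp [Units.smul_def]

end Permutations

/-! ### Wedge products and antisymmetrization -/

section Wedge

open Equiv

variable {E : Type*} [NormedAddCommGroup E] [NormedSpace ℂ E]

theorem wedge_apply {k l : ℕ} (a : E [⋀^Fin k]→L[ℝ] ℂ) (b : E [⋀^Fin l]→L[ℝ] ℂ)
    (v : Fin (k + l) → E) :
    wedge a b v = LinearMap.mul' ℝ ℂ (a.toAlternatingMap.domCoprod b.toAlternatingMap
      (fun i => v (finSumFinEquiv i))) := rfl

@[simp]
theorem castDeg_apply {k l : ℕ} (h : k = l) (a : E [⋀^Fin k]→L[ℝ] ℂ) (v : Fin l → E) :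
    castDeg h a v = a (fun i => v (Fin.cast h i)) := rfl

@[simp]
theorem castDeg_rfl {k : ℕ} (a : E [⋀^Fin k]→L[ℝ] ℂ) : castDeg rfl a = a := rfl

/-- Replaces shuffles by all permutations. Allowing multilinear representatives other than the forms
themselves matters when `a` is itself an antisymmetrization. -/
theorem wedge_apply_of_alternatization {k l : ℕ} {a : E [⋀^Fin k]→L[ℝ] ℂ}
    {b : E [⋀^Fin l]→L[ℝ] ℂ} {x y : ℕ} {m₁ : MultilinearMap ℝ (fun _ : Fin k => E) ℂ}
    {m₂ : MultilinearMap ℝ (fun _ : Fin l => E) ℂ}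
    (ha : MultilinearMap.alternatization m₁ = x • a.toAlternatingMap)
    (hb : MultilinearMap.alternatization m₂ = y • b.toAlternatingMap) (v : Fin (k + l) → E) :
    (x * y) • wedge a b v = ∑ s : Perm (Fin (k + l)), Perm.sign s •
      (m₁ (fun i => v (s (Fin.castAdd l i))) * m₂ (fun j => v (s (Fin.natAdd k j)))) := by
  have h1 : (x * y) • a.toAlternatingMap.domCoprod b.toAlternatingMap =
      MultilinearMap.alternatization (MultilinearMap.domCoprod m₁ m₂) := by
    rw [MultilinearMap.domCoprod_alternization, ha, hb, ← AlternatingMap.domCoprod'_apply,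
      ← AlternatingMap.domCoprod'_apply, ← TensorProduct.smul_tmul', TensorProduct.tmul_smul,
      mul_smul, LinearMap.map_smul_of_tower AlternatingMap.domCoprod',
      LinearMap.map_smul_of_tower AlternatingMap.domCoprod']
  rw [wedge_apply, ← map_nsmul, ← AlternatingMap.smul_apply, h1,
    MultilinearMap.alternatization_apply, map_sum]
  refine Fintype.sum_equiv (Equiv.permCongr finSumFinEquiv) _ _ fun s => ?_
  simp [map_zsmul_unit, MultilinearMap.domCoprod_apply]

/-- After multiplication by `k! l!`, both sides are the same signed sum over permutations of `k + l
+ 1` letters, split on the right by the image of `0`. Associativity and one half of the Leibniz rule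
rest on this. -/
theorem wedge_alternatizeUncurryFin {k l : ℕ} (f : E →L[ℝ] E [⋀^Fin k]→L[ℝ] ℂ)
    (b : E [⋀^Fin l]→L[ℝ] ℂ) (g : E →L[ℝ] E [⋀^Fin (k + l)]→L[ℝ] ℂ)
    (hg : ∀ u, g u = wedge (f u) b) :
    wedge (.alternatizeUncurryFin f) b =
      castDeg (by omega) (ContinuousAlternatingMap.alternatizeUncurryFin g) := by
  let fl : E →ₗ[ℝ] MultilinearMap ℝ (fun _ : Fin k => E) ℂ :=
    { toFun u := (f u).toMultilinearMap
      map_add' u w := by ext; simp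
      map_smul' c u := by ext; simp }
  let m : MultilinearMap ℝ (fun _ : Fin (k + 1) => E) ℂ := LinearMap.uncurryLeft fl
  have hm : ∀ v, m v = f (v 0) (fun i => v i.succ) := fun v => rfl
  have self : ∀ {j : ℕ} (c : E [⋀^Fin j]→L[ℝ] ℂ), MultilinearMap.alternatization
      c.toMultilinearMap = j.factorial • c.toAlternatingMap := fun {j} c => by
    have := AlternatingMap.coe_alternatization c.toAlternatingMap
    simpa using this
  have h1 : MultilinearMap.alternatization m = k.factorial •
      (ContinuousAlternatingMap.alternatizeUncurryFin f).toAlternatingMap := by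
    ext v
    simp only [MultilinearMap.alternatization_apply, MultilinearMap.domDomCongr_apply, hm]
    rw [sum_perm_fin_succ (fun s => f (v (s 0)) (fun i => v (s i.succ)))]
    simp only [AlternatingMap.smul_apply, ContinuousAlternatingMap.coe_toAlternatingMap,
      ContinuousAlternatingMap.alternatizeUncurryFin_apply, Finset.smul_sum (s := Finset.univ),
      Fin.cons_zero, Fin.cons_succ]
    refine Finset.sum_congr rfl fun i _ => ?_
    have h2 := congrArg (fun c => c (i.removeNth v)) (self (f (v i)))
    simp only [MultilinearMap.alternatization_apply, MultilinearMap.domDomCongr_apply] at h2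
    rw [← Finset.smul_sum, smul_comm]
    congr 1
  ext v
  have h3 := wedge_apply_of_alternatization h1 (self b) v
  have hne : ((k.factorial * l.factorial : ℕ) : ℂ) ≠ 0 := by
    exact_mod_cast (mul_pos k.factorial_pos l.factorial_pos).ne'
  apply mul_left_cancel₀ hne
  rw [← nsmul_eq_mul, h3]
  have hkl : k + l + 1 = k + 1 + l := by omega
  set w : Fin (k + l + 1) → E := fun i => v (Fin.cast hkl i) with hw
  -- Reindexing along `k + 1 + l = k + l + 1` exposes the distinguished letter `0`, the slot
  -- differentiated in `f`.
  have h4 : ∑ s : Perm (Fin (k + 1 + l)), Perm.sign s •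
      (m (fun i => v (s (Fin.castAdd l i))) *
        b.toMultilinearMap (fun j => v (s (Fin.natAdd (k + 1) j)))) =
      ∑ s : Perm (Fin (k + l + 1)), Perm.sign s •
        (f (w (s 0)) (fun i => w (s (Fin.castAdd l i).succ)) *
          b (fun j => w (s (Fin.natAdd k j).succ))) := by
    refine Fintype.sum_equiv (Equiv.permCongr (finCongr hkl.symm)) _ _ fun s => ?_
    rw [hm, Equiv.Perm.sign_permCongr]
    simp only [hw, Equiv.permCongr_apply, finCongr_apply, finCongr_symm, Fin.cast_cast,
      Fin.cast_eq_self]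
    congr 2
    refine congrArg b (funext fun j => ?_)
    congr 2
    ext
    simp
    omega
  rw [h4, sum_perm_fin_succ (fun s => f (w (s 0)) (fun i => w (s (Fin.castAdd l i).succ)) *
          b (fun j => w (s (Fin.natAdd k j).succ)))]
  rw [castDeg_apply, ContinuousAlternatingMap.alternatizeUncurryFin_apply, Finset.mul_sum]
  refine Finset.sum_congr rfl fun i _ => ?_
  rw [hg, mul_smul_comm, ← nsmul_eq_mul]
  rw [wedge_apply_of_alternatization (self _) (self b)]
  rfl

end Wedge

/-! ### Algebra of the wedge product -/

section WedgeAlgebra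

open Equiv

variable {E : Type*} [NormedAddCommGroup E] [NormedSpace ℂ E]

/-- Over `ℂ` the factor `k! l!` cancels, so identities for the wedge can be checked on this sum,
where they hold term by term. -/
theorem factorial_mul_wedge_apply {k l : ℕ} (a : E [⋀^Fin k]→L[ℝ] ℂ) (b : E [⋀^Fin l]→L[ℝ] ℂ)
    (v : Fin (k + l) → E) :
    (k.factorial * l.factorial) • wedge a b v = ∑ s : Perm (Fin (k + l)), Perm.sign s •
      (a (fun i => v (s (Fin.castAdd l i))) * b (fun j => v (s (Fin.natAdd k j)))) := by
  have self : ∀ {j : ℕ} (c : E [⋀^Fin j]→L[ℝ] ℂ), MultilinearMap.alternatization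
      c.toMultilinearMap = j.factorial • c.toAlternatingMap := fun {j} c => by
    have := AlternatingMap.coe_alternatization c.toAlternatingMap
    simpa using this
  exact wedge_apply_of_alternatization (self a) (self b) v

theorem eq_of_factorial_nsmul {k l : ℕ} {x y : ℂ}
    (h : (k.factorial * l.factorial) • x = (k.factorial * l.factorial) • y) : x = y := by
  have hne : ((k.factorial * l.factorial : ℕ) : ℂ) ≠ 0 := by
    exact_mod_cast (mul_pos k.factorial_pos l.factorial_pos).ne'
  exact mul_left_cancel₀ hne (by simpa [nsmul_eq_mul] using h)

theorem wedge_add {k l : ℕ} (a : E [⋀^Fin k]→L[ℝ] ℂ) (b b' : E [⋀^Fin l]→L[ℝ] ℂ) :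
    wedge a (b + b') = wedge a b + wedge a b' := by
  ext v
  apply eq_of_factorial_nsmul (k := k) (l := l)
  rw [ContinuousAlternatingMap.add_apply, smul_add]
  simp only [factorial_mul_wedge_apply, ContinuousAlternatingMap.add_apply, mul_add, smul_add,
    Finset.sum_add_distrib]

theorem add_wedge {k l : ℕ} (a a' : E [⋀^Fin k]→L[ℝ] ℂ) (b : E [⋀^Fin l]→L[ℝ] ℂ) :
    wedge (a + a') b = wedge a b + wedge a' b := by
  ext v
  apply eq_of_factorial_nsmul (k := k) (l := l)
  rw [ContinuousAlternatingMap.add_apply, smul_add]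
  simp only [factorial_mul_wedge_apply, ContinuousAlternatingMap.add_apply, add_mul, smul_add,
    Finset.sum_add_distrib]

theorem wedge_smul {k l : ℕ} (c : ℂ) (a : E [⋀^Fin k]→L[ℝ] ℂ) (b : E [⋀^Fin l]→L[ℝ] ℂ) :
    wedge a (c • b) = c • wedge a b := by
  ext v
  apply eq_of_factorial_nsmul (k := k) (l := l)
  rw [ContinuousAlternatingMap.smul_apply, smul_comm]
  simp only [factorial_mul_wedge_apply, ContinuousAlternatingMap.smul_apply, Finset.smul_sum,
    mul_smul_comm]
  exact Finset.sum_congr rfl fun s _ => smul_comm _ _ _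

theorem smul_wedge {k l : ℕ} (c : ℂ) (a : E [⋀^Fin k]→L[ℝ] ℂ) (b : E [⋀^Fin l]→L[ℝ] ℂ) :
    wedge (c • a) b = c • wedge a b := by
  ext v
  apply eq_of_factorial_nsmul (k := k) (l := l)
  rw [ContinuousAlternatingMap.smul_apply, smul_comm]
  simp only [factorial_mul_wedge_apply, ContinuousAlternatingMap.smul_apply, Finset.smul_sum,
    smul_mul_assoc]
  exact Finset.sum_congr rfl fun s _ => smul_comm _ _ _

theorem wedge_compContinuousLinearMap {k l : ℕ} (a : E [⋀^Fin k]→L[ℝ] ℂ)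
    (b : E [⋀^Fin l]→L[ℝ] ℂ) (A : E →L[ℝ] E) :
    (wedge a b).compContinuousLinearMap A =
      wedge (a.compContinuousLinearMap A) (b.compContinuousLinearMap A) := by
  ext v
  apply eq_of_factorial_nsmul (k := k) (l := l)
  rw [ContinuousAlternatingMap.compContinuousLinearMap_apply]
  simp only [factorial_mul_wedge_apply, ContinuousAlternatingMap.compContinuousLinearMap_apply]
  rfl

theorem wedge_of_degree_zero {l : ℕ} (a : E [⋀^Fin 0]→L[ℝ] ℂ) (b : E [⋀^Fin l]→L[ℝ] ℂ) :
    wedge a b = castDeg (zero_add l).symm (a 0 • b) := by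
  ext v
  apply eq_of_factorial_nsmul (k := 0) (l := l)
  have h0 : ∀ w : Fin 0 → E, a w = a 0 := fun w => congrArg a (Subsingleton.elim _ _)
  have hb : ∀ s : Perm (Fin (0 + l)), Perm.sign s • b (fun j => v (s (Fin.natAdd 0 j))) =
      b (fun j => v (Fin.natAdd 0 j)) := fun s => by
    have := (castDeg (zero_add l).symm b).toAlternatingMap.map_perm v s
    have hc : ∀ j : Fin l, Fin.cast (zero_add l).symm j = Fin.natAdd 0 j := fun j => by
      ext; simp
    simp only [ContinuousAlternatingMap.coe_toAlternatingMap, castDeg_apply, Function.comp_def,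
      hc] at this
    rw [this, smul_smul]
    simp
  have hc : ∀ j : Fin l, Fin.cast (zero_add l).symm j = Fin.natAdd 0 j := fun j => by
    ext; simp
  rw [factorial_mul_wedge_apply]
  have hs : ∀ s : Perm (Fin (0 + l)), Perm.sign s • (a (fun i => v (s (Fin.castAdd l i))) *
      b (fun j => v (s (Fin.natAdd 0 j)))) = a 0 * b (fun j => v (Fin.natAdd 0 j)) := fun s => by
    rw [h0, ← mul_smul_comm, hb]
  rw [Finset.sum_congr rfl fun s _ => hs s]
  have hf : (0 + l).factorial = l.factorial := by rw [zero_add]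
  simp only [Finset.sum_const, Finset.card_univ, Fintype.card_perm, Fintype.card_fin, hf,
    Nat.factorial_zero, one_mul, castDeg_apply, ContinuousAlternatingMap.smul_apply, smul_eq_mul,
    hc]

theorem castDeg_castDeg {k l m : ℕ} (h : k = l) (h' : l = m) (a : E [⋀^Fin k]→L[ℝ] ℂ) :
    castDeg h' (castDeg h a) = castDeg (h.trans h') a := by
  subst h h'; rfl

theorem castDeg_wedge {k k' l : ℕ} (h : k = k') (a : E [⋀^Fin k]→L[ℝ] ℂ)
    (b : E [⋀^Fin l]→L[ℝ] ℂ) :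
    wedge (castDeg h a) b = castDeg (by rw [h]) (wedge a b) := by
  subst h; rfl

theorem wedge_castDeg {k l l' : ℕ} (h : l = l') (a : E [⋀^Fin k]→L[ℝ] ℂ)
    (b : E [⋀^Fin l]→L[ℝ] ℂ) :
    wedge a (castDeg h b) = castDeg (by rw [h]) (wedge a b) := by
  subst h; rfl

theorem castDeg_smul {k l : ℕ} (h : k = l) (c : ℂ) (a : E [⋀^Fin k]→L[ℝ] ℂ) :
    castDeg h (c • a) = c • castDeg h a := by
  subst h; rfl

theorem castDeg_add {k l : ℕ} (h : k = l) (a b : E [⋀^Fin k]→L[ℝ] ℂ) :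
    castDeg h (a + b) = castDeg h a + castDeg h b := by
  subst h; rfl

theorem alternatizeUncurryFin_castDeg {k l : ℕ} (h : k = l)
    (f : E →L[ℝ] E [⋀^Fin k]→L[ℝ] ℂ) (g : E →L[ℝ] E [⋀^Fin l]→L[ℝ] ℂ)
    (hg : ∀ u, g u = castDeg h (f u)) :
    ContinuousAlternatingMap.alternatizeUncurryFin g =
      castDeg (by rw [h]) (ContinuousAlternatingMap.alternatizeUncurryFin f) := by
  subst h
  have : g = f := ContinuousLinearMap.ext hg
  rw [this, castDeg_rfl]

variable [FiniteDimensional ℂ E]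

/-- The linear map `u ↦ f u ∧ b`. -/
def wedgeRight {k l : ℕ} (f : E →L[ℝ] E [⋀^Fin k]→L[ℝ] ℂ) (b : E [⋀^Fin l]→L[ℝ] ℂ) :
    E →L[ℝ] E [⋀^Fin (k + l)]→L[ℝ] ℂ :=
  haveI : FiniteDimensional ℝ E := FiniteDimensional.complexToReal E
  LinearMap.toContinuousLinearMap
    { toFun u := wedge (f u) b
      map_add' u w := by rw [map_add, add_wedge]
      map_smul' c u := by
        have := smul_wedge (c : ℂ) (f u) b
        have h1 : ∀ {j : ℕ} (x : E [⋀^Fin j]→L[ℝ] ℂ), (c : ℂ) • x = c • x := fun x => by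
          ext; simp
        rwa [h1, h1, ← map_smul] at this }

@[simp]
theorem wedgeRight_apply {k l : ℕ} (f : E →L[ℝ] E [⋀^Fin k]→L[ℝ] ℂ) (b : E [⋀^Fin l]→L[ℝ] ℂ)
    (u : E) : wedgeRight f b u = wedge (f u) b := rfl

/-- Induction on the degree of `a`: a `(k+1)`-form is `(k+1)⁻¹` times the antisymmetrization of its
own currying, and antisymmetrization passes through wedging on the right. -/
theorem wedge_assoc {k l j : ℕ} (a : E [⋀^Fin k]→L[ℝ] ℂ) (b : E [⋀^Fin l]→L[ℝ] ℂ)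
    (c : E [⋀^Fin j]→L[ℝ] ℂ) :
    wedge (wedge a b) c = castDeg (by omega) (wedge a (wedge b c)) := by
  induction k with
  | zero =>
    rw [wedge_of_degree_zero, wedge_of_degree_zero, castDeg_wedge, castDeg_castDeg, smul_wedge]
  | succ k ih =>
    have key : ∀ f : E →L[ℝ] E [⋀^Fin k]→L[ℝ] ℂ,
        wedge (wedge (.alternatizeUncurryFin f) b) c =
          castDeg (by omega) (wedge (.alternatizeUncurryFin f) (wedge b c)) := fun f => by
      rw [wedge_alternatizeUncurryFin f b (wedgeRight f b) fun _ => rfl, castDeg_wedge,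
        wedge_alternatizeUncurryFin (wedgeRight f b) c (wedgeRight (wedgeRight f b) c)
          fun _ => rfl,
        wedge_alternatizeUncurryFin f (wedge b c) (wedgeRight f (wedge b c)) fun _ => rfl,
        alternatizeUncurryFin_castDeg _ (wedgeRight f (wedge b c))
          (wedgeRight (wedgeRight f b) c) fun u => ih (f u)]
      simp only [castDeg_castDeg]
    have ha : a = ((k : ℂ) + 1)⁻¹ • ContinuousAlternatingMap.alternatizeUncurryFin a.curryLeft := by
      rw [ContinuousAlternatingMap.alternatizeUncurryFin_curryLeft]
      have : (k : ℂ) + 1 ≠ 0 := by exact_mod_cast k.succ_ne_zero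
      ext v
      simp [this]
    rw [ha, smul_wedge, smul_wedge, smul_wedge, key, castDeg_smul]

end WedgeAlgebra

/-! ### Canonical anticommutation relations and the `sl₂` commutator -/

/-- Two families of elements of a ring satisfying the canonical anticommutation relations. -/
structure IsCAR {ι A : Type*} [DecidableEq ι] [Ring A] (M D : ι → A) : Prop where
  creation : ∀ i j, M i * M j = -(M j * M i)
  annihilation : ∀ i j, D i * D j = -(D j * D i)
  mixed : ∀ i j, D i * M j = (if i = j then 1 else 0) - M j * D i

namespace IsCAR

variable {ι A : Type*} [Fintype ι] [DecidableEq ι] [Ring A] {M D : ι → A}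

/-- The number operator `∑ Mᵢ Dᵢ`. -/
def number (M D : ι → A) : A := ∑ i, M i * D i

theorem number_mul_creation (h : IsCAR M D) (j : ι) :
    number M D * M j = M j * number M D + M j := by
  have h1 : ∀ i, M i * D i * M j = M j * (M i * D i) + if i = j then M j else 0 := fun i => by
    rw [mul_assoc, h.mixed, mul_sub, ← mul_assoc (M i) (M j), h.creation i j]
    split_ifs with hij
    · subst hij; noncomm_ring
    · noncomm_ring
  simp only [number, Finset.sum_mul, Finset.mul_sum, h1, Finset.sum_add_distrib]
  simp

theorem number_mul_annihilation (h : IsCAR M D) (j : ι) :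
    number M D * D j = D j * number M D - D j := by
  have h1 : ∀ i, D j * (M i * D i) = M i * D i * D j + if j = i then D j else 0 := fun i => by
    rw [← mul_assoc, h.mixed, sub_mul, mul_assoc (M i) (D j), h.annihilation j i]
    split_ifs with hij
    · subst hij; noncomm_ring
    · noncomm_ring
  simp only [number, Finset.sum_mul, Finset.mul_sum, h1, Finset.sum_add_distrib]
  simp

variable [Algebra ℂ A]

/-- The quadratic element `½ ∑ sᵢⱼ xᵢ xⱼ`. -/
def quad (s : Matrix ι ι ℂ) (x : ι → A) : A := (1 / 2 : ℂ) • ∑ i, ∑ j, s i j • (x i * x j)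

theorem number_mul_quad_creation (h : IsCAR M D) (s : Matrix ι ι ℂ) :
    number M D * quad s M = quad s M * number M D + (2 : ℂ) • quad s M := by
  have h1 : ∀ i j, number M D * (M i * M j) = M i * M j * number M D + (2 : ℂ) • (M i * M j) :=
    fun i j => by
      rw [← mul_assoc, h.number_mul_creation, add_mul, mul_assoc, h.number_mul_creation, two_smul]
      noncomm_ring
  simp only [quad, mul_smul_comm, smul_mul_assoc, Finset.mul_sum, Finset.sum_mul, h1, smul_add,
    Finset.sum_add_distrib, smul_comm (2 : ℂ), Finset.smul_sum]

theorem number_mul_quad_annihilation (h : IsCAR M D) (t : Matrix ι ι ℂ) :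
    number M D * quad t D = quad t D * number M D - (2 : ℂ) • quad t D := by
  have h1 : ∀ i j, number M D * (D i * D j) = D i * D j * number M D - (2 : ℂ) • (D i * D j) :=
    fun i j => by
      rw [← mul_assoc, h.number_mul_annihilation, sub_mul, mul_assoc, h.number_mul_annihilation,
        two_smul]
      noncomm_ring
  simp only [quad, mul_smul_comm, smul_mul_assoc, Finset.mul_sum, Finset.sum_mul, h1, smul_sub,
    Finset.sum_sub_distrib, smul_comm (2 : ℂ), Finset.smul_sum]

/-- `D l` acts as an antiderivation, so the commutator is the contraction of `½ ∑ sᵢⱼ Mᵢ Mⱼ` with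
the `l`-th vector. Antisymmetry of `s` makes its two terms equal and cancels the `½`. -/
theorem annihilation_mul_quad (h : IsCAR M D) {s : Matrix ι ι ℂ} (hs : ∀ i j, s j i = -s i j)
    (l : ι) : D l * quad s M = quad s M * D l + ∑ j, s l j • M j := by
  have h1 : ∀ i j, D l * (M i * M j) = M i * M j * D l + ((if l = i then M j else 0) -
      if l = j then M i else 0) := fun i j => by
    rw [← mul_assoc, h.mixed, sub_mul, mul_assoc (M i) (D l), h.mixed, mul_sub]
    split_ifs <;> noncomm_ring
  have h2 : ∑ i, ∑ j, s i j • ((if l = i then M j else 0) - if l = j then M i else 0) =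
      (2 : ℂ) • ∑ j, s l j • M j := by
    simp only [smul_sub, smul_ite, smul_zero, Finset.sum_sub_distrib]
    rw [Finset.sum_comm]
    simp only [Finset.sum_ite_eq, Finset.mem_univ, if_true]
    rw [two_smul, sub_eq_add_neg, ← Finset.sum_neg_distrib]
    congr 1
    refine Finset.sum_congr rfl fun i _ => ?_
    rw [hs l i, neg_smul, neg_neg]
  simp only [quad, mul_smul_comm, smul_mul_assoc, Finset.mul_sum, Finset.sum_mul, h1]
  simp only [smul_add (_ : ℂ) (_ * _ * _ : A), Finset.sum_add_distrib]
  rw [h2, smul_add, smul_smul]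
  norm_num

/-- Moving `Dᵢ Dⱼ` past the quadratic element leaves two linear contractions. Summed against `t =
s⁻¹`, the first gives `∑ Dᵢ Mᵢ = 2n - N` and the second `-N`; half their sum is `n - N`. -/
theorem quad_commutator (h : IsCAR M D) {s t : Matrix ι ι ℂ} (hs : ∀ i j, s j i = -s i j)
    (hts : t * s = 1) {n : ℕ} (hn : Fintype.card ι = 2 * n) :
    quad t D * quad s M = quad s M * quad t D + ((n : ℂ) • 1 - number M D) := by
  have hst : s * t = 1 := mul_eq_one_comm.1 hts
  have h1 : ∀ i j, D i * D j * quad s M = quad s M * (D i * D j) +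
      ((∑ l, s j l • (D i * M l)) + ∑ l, s i l • (M l * D j)) := fun i j => by
    rw [mul_assoc, h.annihilation_mul_quad hs, mul_add, ← mul_assoc,
      h.annihilation_mul_quad hs, add_mul, Finset.mul_sum, Finset.sum_mul]
    simp only [mul_smul_comm, smul_mul_assoc, mul_assoc]
    abel
  have h2 : ∑ i, ∑ j, t i j • ∑ l, s j l • (D i * M l) = (2 * n : ℂ) • 1 - number M D := by
    have h3 : ∀ i, ∑ j, t i j • ∑ l, s j l • (D i * M l) = 1 - M i * D i := fun i => by
      simp only [Finset.smul_sum, smul_smul]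
      rw [Finset.sum_comm]
      simp only [← Finset.sum_smul, ← Matrix.mul_apply, hts, Matrix.one_apply, ite_smul,
        one_smul, zero_smul, Finset.sum_ite_eq, Finset.mem_univ, if_true]
      simpa using h.mixed i i
    simp only [h3, Finset.sum_sub_distrib, number]
    congr 1
    rw [Finset.sum_const, Finset.card_univ, hn, ← Nat.cast_smul_eq_nsmul ℂ]
    push_cast
    rfl
  have h4 : ∑ i, ∑ j, t i j • ∑ l, s i l • (M l * D j) = -number M D := by
    have h5 : ∀ j, ∑ i, t i j • ∑ l, s i l • (M l * D j) = -(M j * D j) := fun j => by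
      simp only [Finset.smul_sum, smul_smul]
      rw [Finset.sum_comm]
      have h6 : ∀ l, ∑ i, (t i j * s i l) • (M l * D j) =
          (-(1 : Matrix ι ι ℂ) l j) • (M l * D j) := fun l => by
        rw [← Finset.sum_smul, ← hst, Matrix.mul_apply, ← Finset.sum_neg_distrib]
        congr 1
        refine Finset.sum_congr rfl fun i _ => ?_
        rw [hs l i]; ring
      simp [h6, Matrix.one_apply]
    rw [Finset.sum_comm]
    simp only [h5, number, Finset.sum_neg_distrib]
  have h7 : quad t D * quad s M = quad s M * quad t D + (1 / 2 : ℂ) •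
      (∑ i, ∑ j, t i j • ∑ l, s j l • (D i * M l) +
        ∑ i, ∑ j, t i j • ∑ l, s i l • (M l * D j)) := by
    rw [show quad t D = (1 / 2 : ℂ) • ∑ i, ∑ j, t i j • (D i * D j) from rfl]
    simp only [smul_mul_assoc, mul_smul_comm, Finset.sum_mul, Finset.mul_sum, h1, smul_add,
      Finset.sum_add_distrib]
  rw [h7, h2, h4]
  congr 1
  module

end IsCAR

/-! ### Representation theory: spectrum of `N` and powers of `K` and `L` -/

section Modules

variable {V : Type*} [AddCommGroup V] [Module ℂ V]

/-- Commuting idempotents: their sum over `s` has no eigenvalue outside `{0, …, |s|}`. -/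
theorem eq_zero_of_sum_idempotents {ι : Type*} (P : ι → Module.End ℂ V)
    (hP : ∀ i, P i * P i = P i) (hc : ∀ i j, P i * P j = P j * P i) (s : Finset ι) :
    ∀ (c : ℂ) (x : V), (∀ m : ℕ, m ≤ s.card → c ≠ m) → (∑ i ∈ s, P i) x = c • x → x = 0 := by
  classical
  induction s using Finset.induction_on with
  | empty =>
    intro c x hcn hx
    have : c ≠ 0 := by simpa using hcn 0 le_rfl
    simpa [this] using hx.symm
  | insert a s ha ih =>
    intro c x hcn hx
    rw [Finset.card_insert_of_notMem ha] at hcn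
    rw [Finset.sum_insert ha, LinearMap.add_apply] at hx
    have hcomm : (∑ i ∈ s, P i) * P a = P a * ∑ i ∈ s, P i := by
      rw [Finset.sum_mul, Finset.mul_sum]
      exact Finset.sum_congr rfl fun i _ => hc i a
    have hidem : P a (P a x) = P a x := LinearMap.congr_fun (hP a) x
    have h1 : (∑ i ∈ s, P i) (P a x) = P a ((∑ i ∈ s, P i) x) := LinearMap.congr_fun hcomm x
    have h2 : (∑ i ∈ s, P i) x = c • x - P a x := by rw [← hx]; abel
    -- `P a x` is an eigenvector of the shorter sum with eigenvalue `c - 1`, and `c - 1` avoids `{0,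
    -- …, |s|}` because `c` avoids `{1, …, |s| + 1}`.
    have h3 : P a x = 0 := by
      refine ih (c - 1) _ (fun m hm he => hcn (m + 1) (by omega) ?_) ?_
      · push_cast; rw [← he]; ring
      · rw [h1, h2, map_sub, hidem, map_smul]; module
    exact ih c x (fun m hm => hcn m (by omega)) (by rw [h2, h3, sub_zero])

variable {L K N : Module.End ℂ V} {n : ℕ}

theorem pow_eigenvector {c : ℂ} (hN : N * L = L * N + c • L) {p : ℂ} {x : V}
    (hx : N x = p • x) (k : ℕ) : N ((L ^ k) x) = (p + c * k) • (L ^ k) x := by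
  induction k with
  | zero => simpa using hx
  | succ k ih =>
    have := LinearMap.congr_fun hN ((L ^ k) x)
    simp only [Module.End.mul_apply, LinearMap.add_apply, LinearMap.smul_apply, ih] at this
    rw [pow_succ', Module.End.mul_apply, this, map_smul]
    push_cast
    module

/-- The constant `∏_{k < m} (k + 1) (n - 1 - k)` of the `sl₂` computation. -/
def lefschetzConst (n m : ℕ) : ℂ := ∏ k ∈ Finset.range m, ((k : ℂ) + 1) * ((n : ℂ) - 1 - k)

theorem lefschetzConst_ne_zero {n m : ℕ} (h : m + 1 ≤ n) : lefschetzConst n m ≠ 0 := by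
  refine Finset.prod_ne_zero_iff.2 fun k hk => mul_ne_zero ?_ ?_
  · exact_mod_cast k.succ_ne_zero
  · have hk := Finset.mem_range.1 hk
    rw [sub_sub, sub_ne_zero]
    exact_mod_cast (by omega : n ≠ 1 + k)

/-- Commuting `K` through `L^(k+1)` collects the eigenvalues `n - 1 - 2j` of `n - N` for `j ≤ k`,
whose sum is `(k+1)(n-1-k)`. -/
theorem lowering_pow_raising_pow (hK : K * L = L * K + ((n : ℂ) • 1 - N))
    (hN : N * L = L * N + (2 : ℂ) • L) {x : V} (hx : N x = (1 : ℂ) • x) (h0 : K x = 0) (m : ℕ) :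
    (K ^ m) ((L ^ m) x) = lefschetzConst n m • x := by
  have step : ∀ k : ℕ, K ((L ^ (k + 1)) x) =
      (((k : ℂ) + 1) * ((n : ℂ) - 1 - k)) • (L ^ k) x := by
    intro k
    have e : ∀ y, K (L y) = L (K y) + ((n : ℂ) • y - N y) := fun y => by
      simpa using LinearMap.congr_fun hK y
    induction k with
    | zero =>
      have := e x
      rw [h0, map_zero, hx] at this
      simp only [zero_add, pow_one, this]
      simp only [pow_zero, Module.End.one_apply, Nat.cast_zero]
      module
    | succ k ih =>
      rw [pow_succ', Module.End.mul_apply, e, ih, pow_eigenvector hN hx, map_smul,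
        ← Module.End.mul_apply, ← pow_succ']
      push_cast
      module
  induction m with
  | zero => simp [lefschetzConst]
  | succ m ih =>
    rw [pow_succ, Module.End.mul_apply, step, map_smul, ih, lefschetzConst, lefschetzConst,
      Finset.prod_range_succ, smul_smul, mul_comm]

theorem lowering_commutator (hN : N * K = K * N - (2 : ℂ) • K) :
    N * K = K * N + (-2 : ℂ) • K := by
  rw [hN, neg_smul, sub_eq_add_neg]

/-- The mirror image: `N - n` takes the values `n - 1 - 2j` along `K^j x`, so the constant is the
same. -/
theorem raising_pow_lowering_pow (hK : K * L = L * K + ((n : ℂ) • 1 - N))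
    (hN : N * K = K * N - (2 : ℂ) • K) {x : V} (hx : N x = (2 * n - 1 : ℂ) • x) (h0 : L x = 0)
    (m : ℕ) : (L ^ m) ((K ^ m) x) = lefschetzConst n m • x := by
  have hN' := lowering_commutator hN
  have step : ∀ k : ℕ, L ((K ^ (k + 1)) x) =
      (((k : ℂ) + 1) * ((n : ℂ) - 1 - k)) • (K ^ k) x := by
    intro k
    have e : ∀ y, L (K y) = K (L y) - ((n : ℂ) • y - N y) := fun y => by
      have : K (L y) = L (K y) + ((n : ℂ) • y - N y) := by
        simpa using LinearMap.congr_fun hK y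
      rw [this]; abel
    induction k with
    | zero =>
      have := e x
      rw [h0, map_zero, hx] at this
      simp only [zero_add, pow_one, this]
      simp only [pow_zero, Module.End.one_apply, Nat.cast_zero]
      module
    | succ k ih =>
      rw [pow_succ', Module.End.mul_apply, e, ih, pow_eigenvector hN' hx, map_smul,
        ← Module.End.mul_apply, ← pow_succ']
      push_cast
      module
  induction m with
  | zero => simp [lefschetzConst]
  | succ m ih =>
    rw [pow_succ, Module.End.mul_apply, step, map_smul, ih, lefschetzConst, lefschetzConst,
      Finset.prod_range_succ, smul_smul, mul_comm]

/-- The `Mᵢ Dᵢ` are commuting idempotents, so their sum has eigenvalues only in `{0, …, |ι|}`. This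
bounds the holomorphic degree without decomposing forms into monomials. -/
theorem IsCAR.eq_zero_of_number {ι : Type*} [Fintype ι] [DecidableEq ι]
    {M D : ι → Module.End ℂ V} (h : IsCAR M D) {c : ℂ} {x : V}
    (hc : ∀ m : ℕ, m ≤ Fintype.card ι → c ≠ m) (hx : IsCAR.number M D x = c • x) : x = 0 := by
  refine eq_zero_of_sum_idempotents (fun i => M i * D i) (fun i => ?_) (fun i j => ?_)
    Finset.univ c x hc hx
  · have h2 : M i * M i = 0 := by
      have h3 := h.creation i i
      have : (2 : ℂ) • (M i * M i) = 0 := by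
        rw [two_smul]; nth_rewrite 1 [h3]; abel
      simpa using this
    calc M i * D i * (M i * D i) = M i * (D i * M i) * D i := by noncomm_ring
      _ = M i * D i - (M i * M i) * (D i * D i) := by
        rw [h.mixed]; simp only [if_true]; noncomm_ring
      _ = M i * D i := by rw [h2]; simp
  · by_cases hij : i = j
    · rw [hij]
    · calc M i * D i * (M j * D j) = M i * (D i * M j) * D j := by noncomm_ring
        _ = -((M i * M j) * (D i * D j)) := by
          rw [h.mixed, if_neg hij]; noncomm_ring
        _ = -((M j * M i) * (D j * D i)) := by
          rw [h.creation i j, h.annihilation i j, neg_mul_neg]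
        _ = M j * (D j * M i) * D i := by
          rw [h.mixed, if_neg (Ne.symm hij)]; noncomm_ring
        _ = M j * D j * (M i * D i) := by noncomm_ring

end Modules

/-! ### Exterior multiplication and contraction as operators on all forms -/

section Operators

variable {E : Type*} [NormedAddCommGroup E] [NormedSpace ℂ E]

/-- The linear map `b ↦ θ ∧ b`, for a `1`-form `θ`. -/
def extMul (θ : E →L[ℝ] ℂ) (k : ℕ) : (E [⋀^Fin k]→L[ℝ] ℂ) →ₗ[ℂ] E [⋀^Fin (k + 1)]→L[ℝ] ℂ where
  toFun b := .alternatizeUncurryFin (θ.smulRight b)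
  map_add' b c := by
    rw [← ContinuousAlternatingMap.alternatizeUncurryFin_add]
    congr 1; ext; simp
  map_smul' z b := by
    rw [RingHom.id_apply, ← ContinuousAlternatingMap.alternatizeUncurryFin_smul]
    congr 1; ext; simp; ring

theorem extMul_apply (θ : E →L[ℝ] ℂ) (k : ℕ) (b : E [⋀^Fin k]→L[ℝ] ℂ) (v : Fin (k + 1) → E) :
    extMul θ k b v = ∑ i : Fin (k + 1), (-1) ^ (i : ℕ) • (θ (v i) * b (i.removeNth v)) := by
  simp [extMul, ContinuousAlternatingMap.alternatizeUncurryFin_apply]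

/-- The interior product with `u`. -/
def contract (u : E) (k : ℕ) : (E [⋀^Fin (k + 1)]→L[ℝ] ℂ) →ₗ[ℂ] E [⋀^Fin k]→L[ℝ] ℂ where
  toFun b := b.curryLeft u
  map_add' b c := by ext; simp
  map_smul' z b := by ext; simp

@[simp]
theorem contract_apply (u : E) (k : ℕ) (b : E [⋀^Fin (k + 1)]→L[ℝ] ℂ) (v : Fin k → E) :
    contract u k b v = b (Fin.cons u v) := rfl

theorem contract_add (u w : E) (k : ℕ) :
    contract (u + w) k = contract u k + contract w k := by
  ext b v
  exact congrArg (fun c => c v) (map_add b.curryLeft u w)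

theorem contract_real_smul (r : ℝ) (u : E) (k : ℕ) :
    contract (r • u) k = (r : ℂ) • contract u k := by
  ext b v
  exact congrArg (fun c => c v) (map_smul b.curryLeft r u)

theorem contract_extMul_zero (u : E) (θ : E →L[ℝ] ℂ) (b : E [⋀^Fin 0]→L[ℝ] ℂ) :
    contract u 0 (extMul θ 0 b) = θ u • b := by
  ext v
  rw [contract_apply, extMul_apply]
  simp

theorem contract_extMul_succ (u : E) (θ : E →L[ℝ] ℂ) (k : ℕ) (b : E [⋀^Fin (k + 1)]→L[ℝ] ℂ) :
    contract u (k + 1) (extMul θ (k + 1) b) = θ u • b - extMul θ k (contract u k b) := by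
  ext v
  have h : ∀ i : Fin (k + 1), Fin.removeNth i.succ (Fin.cons u v : Fin (k + 2) → E) =
      Fin.cons u (i.removeNth v) := fun i => by
    funext j
    refine Fin.cases ?_ (fun j => ?_) j <;> simp [Fin.removeNth]
  rw [contract_apply, extMul_apply, Fin.sum_univ_succ]
  simp only [h, Fin.cons_zero, Fin.cons_succ, ContinuousAlternatingMap.sub_apply,
    ContinuousAlternatingMap.smul_apply, extMul_apply, contract_apply]
  simp only [Fin.val_zero, pow_zero, one_smul, Fin.removeNth_zero, Fin.tail_cons, smul_eq_mul,
    Fin.val_succ, pow_succ, mul_neg_one, neg_smul, Finset.sum_neg_distrib]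
  ring

theorem contract_contract_self (u : E) (k : ℕ) (b : E [⋀^Fin (k + 2)]→L[ℝ] ℂ) :
    contract u k (contract u (k + 1) b) = 0 :=
  ContinuousAlternatingMap.curryLeft_same b u

theorem contract_contract (u w : E) (k : ℕ) (b : E [⋀^Fin (k + 2)]→L[ℝ] ℂ) :
    contract u k (contract w (k + 1) b) = -contract w k (contract u (k + 1) b) := by
  have h := contract_contract_self (u + w) k b
  simp only [contract_add, LinearMap.add_apply, map_add, contract_contract_self, zero_add,
    add_zero] at h
  exact eq_neg_of_add_eq_zero_right h

/-- The sum of the two sides antisymmetrizes twice the symmetric map `(x, y) ↦ θ x • g y + θ y • g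
x`, hence vanishes. It yields both the anticommutation of `1`-forms and the sign in the Leibniz
rule. -/
theorem alternatizeUncurryFin_extMul (θ : E →L[ℝ] ℂ) (k : ℕ) (g : E →L[ℝ] E [⋀^Fin k]→L[ℝ] ℂ)
    (g' : E →L[ℝ] E [⋀^Fin (k + 1)]→L[ℝ] ℂ) (hg : ∀ u, g' u = extMul θ k (g u)) :
    ContinuousAlternatingMap.alternatizeUncurryFin g' =
      -extMul θ (k + 1) (.alternatizeUncurryFin g) := by
  let B : ℂ →L[ℝ] (E [⋀^Fin k]→L[ℝ] ℂ) →L[ℝ] E [⋀^Fin k]→L[ℝ] ℂ :=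
    ContinuousLinearMap.lsmul ℝ ℂ
  let f := B.bilinearComp θ g
  have h1 : g' = ContinuousAlternatingMap.alternatizeUncurryFinCLM ℝ E ℂ ∘L f.flip := by
    ext1 x
    rw [hg]
    change ContinuousAlternatingMap.alternatizeUncurryFin _ =
      ContinuousAlternatingMap.alternatizeUncurryFin _
    congr 1
  have h2 : extMul θ (k + 1) (.alternatizeUncurryFin g) =
      .alternatizeUncurryFin (ContinuousAlternatingMap.alternatizeUncurryFinCLM ℝ E ℂ ∘L f) := by
    change ContinuousAlternatingMap.alternatizeUncurryFin _ = _
    congr 1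
    ext1 x
    change θ x • ContinuousAlternatingMap.alternatizeUncurryFin g =
      ContinuousAlternatingMap.alternatizeUncurryFin (f x)
    rw [← ContinuousAlternatingMap.alternatizeUncurryFin_smul]
    congr 1
  rw [eq_neg_iff_add_eq_zero, h1, h2, ← ContinuousAlternatingMap.alternatizeUncurryFin_add,
    ← ContinuousLinearMap.comp_add]
  refine ContinuousAlternatingMap.alternatizeUncurryFin_alternatizeUncurryFinCLM_comp_of_symmetric
    fun x y => ?_
  simp [add_comm]

theorem extMul_extMul (θ φ : E →L[ℝ] ℂ) (k : ℕ) (b : E [⋀^Fin k]→L[ℝ] ℂ) :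
    extMul θ (k + 1) (extMul φ k b) = -extMul φ (k + 1) (extMul θ k b) :=
  alternatizeUncurryFin_extMul φ k (θ.smulRight b) _ fun u => by
    simp [ContinuousLinearMap.smulRight_apply]

/-- Families of forms, one in each degree. -/
abbrev Tot (E : Type*) [NormedAddCommGroup E] [NormedSpace ℂ E] : Type _ :=
  (k : ℕ) → E [⋀^Fin k]→L[ℝ] ℂ

/-- `θ ∧ ·` on forms of all degrees. -/
def totMul (θ : E →L[ℝ] ℂ) : Module.End ℂ (Tot E) where
  toFun F := fun k => match k with
    | 0 => 0
    | k + 1 => extMul θ k (F k)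
  map_add' F G := by
    funext k
    cases k <;> simp
  map_smul' c F := by
    funext k
    cases k
    · exact (smul_zero (A := E [⋀^Fin 0]→L[ℝ] ℂ) c).symm
    · simp

@[simp]
theorem totMul_zero (θ : E →L[ℝ] ℂ) (F : Tot E) : totMul θ F 0 = 0 := rfl

@[simp]
theorem totMul_succ (θ : E →L[ℝ] ℂ) (F : Tot E) (k : ℕ) :
    totMul θ F (k + 1) = extMul θ k (F k) := rfl

/-- The interior product with `u` on forms of all degrees. -/
def totContract (u : E) : Module.End ℂ (Tot E) where
  toFun F := fun k => contract u k (F (k + 1))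
  map_add' F G := by
    funext k
    simp
  map_smul' c F := by
    funext k
    simp

@[simp]
theorem totContract_apply (u : E) (F : Tot E) (k : ℕ) :
    totContract u F k = contract u k (F (k + 1)) := rfl

theorem totMul_mul (θ φ : E →L[ℝ] ℂ) : totMul θ * totMul φ = -(totMul φ * totMul θ) := by
  refine LinearMap.ext fun F => funext fun k => ?_
  match k with
  | 0 => simp
  | 1 => simp
  | k + 2 => simpa using extMul_extMul θ φ k (F k)

theorem totContract_mul (u w : E) :
    totContract u * totContract w = -(totContract w * totContract u) := by
  refine LinearMap.ext fun F => funext fun k => ?_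
  simpa using contract_contract u w k (F (k + 2))

theorem totContract_mul_totMul (u : E) (θ : E →L[ℝ] ℂ) :
    totContract u * totMul θ = θ u • 1 - totMul θ * totContract u := by
  refine LinearMap.ext fun F => funext fun k => ?_
  cases k with
  | zero => simpa using contract_extMul_zero u θ (F 0)
  | succ k => simpa using contract_extMul_succ u θ k (F (k + 1))

/-- The interior product with the `(1,0)`-part of `u`. -/
def holContract (u : E) : Module.End ℂ (Tot E) :=
  (1 / 2 : ℂ) • (totContract u - Complex.I • totContract (Complex.I • u))

theorem holContract_apply_apply (u : E) (F : Tot E) (k : ℕ) (v : Fin k → E) :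
    holContract u F k v = (1 / 2 : ℂ) * (F (k + 1) (Fin.cons u v) -
      Complex.I * F (k + 1) (Fin.cons (Complex.I • u) v)) := by
  simp [holContract]

/-- The `(1,0)`-part of `u` depends complex-linearly on `u`, unlike `totContract u`, so it expands
in a complex basis. -/
theorem sum_coord_mul_holContract {ι : Type*} [Fintype ι] (e : Module.Basis ι ℂ E) (u : E) (F : Tot E) (k : ℕ) (v : Fin k → E) :
    ∑ i, e.repr u i * holContract (e i) F k v = holContract u F k v := by
  let G : E →ₗ[ℂ] ℂ :=
    { toFun w := holContract w F k v
      map_add' w w' := by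
        simp only [holContract_apply_apply, ← contract_apply, smul_add, contract_add,
          LinearMap.add_apply, ContinuousAlternatingMap.add_apply]
        ring
      map_smul' c w := by
        have h : c • w = c.re • w + c.im • (Complex.I • w) := by
          conv_lhs => rw [← Complex.re_add_im c]
          rw [add_smul, mul_smul, Complex.coe_smul, Complex.coe_smul]
        have h' : Complex.I • (c • w) = c.re • (Complex.I • w) + (-c.im) • w := by
          rw [h, smul_add, smul_comm Complex.I, smul_comm Complex.I c.im, smul_smul,
            Complex.I_mul_I]
          simp
        have hc : c = c.re + c.im * Complex.I := (Complex.re_add_im c).symm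
        simp only [holContract_apply_apply, ← contract_apply, h']
        simp only [h, contract_add,
          contract_real_smul, LinearMap.add_apply, LinearMap.smul_apply,
          ContinuousAlternatingMap.add_apply, ContinuousAlternatingMap.smul_apply, smul_eq_mul,
          RingHom.id_apply, Complex.ofReal_neg]
        linear_combination (1 / 2 * c.im * contract (Complex.I • w) k (F (k + 1)) v) *
          Complex.I_mul_I - (1 / 2 * (contract w k (F (k + 1)) v -
            Complex.I * contract (Complex.I • w) k (F (k + 1)) v)) * hc }
  have := congrArg G (e.sum_repr u)
  rw [map_sum] at this
  simpa [G] using this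

theorem anticomm_holPart {A : Type*} [Ring A] [Algebra ℂ A] {a a' b b' : A}
    (h1 : a * b = -(b * a)) (h2 : a * b' = -(b' * a)) (h3 : a' * b = -(b * a'))
    (h4 : a' * b' = -(b' * a')) :
    ((1 / 2 : ℂ) • (a - Complex.I • a')) * ((1 / 2 : ℂ) • (b - Complex.I • b')) =
      -(((1 / 2 : ℂ) • (b - Complex.I • b')) * ((1 / 2 : ℂ) • (a - Complex.I • a'))) := by
  simp only [smul_mul_assoc, mul_smul_comm, sub_mul, mul_sub, h1, h2, h3, h4]
  module

/-- For a complex-linear `1`-form the pairings with `u` and `i u` are `z` and `i z`, and `½ (z - i ·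
i z) = z`. -/
theorem holPart_mul {A : Type*} [Ring A] [Algebra ℂ A] {a a' m : A} {z : ℂ}
    (h1 : a * m = z • 1 - m * a) (h2 : a' * m = (Complex.I * z) • 1 - m * a') :
    ((1 / 2 : ℂ) • (a - Complex.I • a')) * m =
      z • 1 - m * ((1 / 2 : ℂ) • (a - Complex.I • a')) := by
  simp only [smul_mul_assoc, mul_smul_comm, sub_mul, mul_sub, h1, h2, smul_sub, smul_smul]
  have hI : 1 / 2 * Complex.I * (Complex.I * z) = -(1 / 2 * z) := by
    linear_combination (1 / 2 * z) * Complex.I_mul_I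
  rw [hI]
  module

variable {ι : Type*} (e : Module.Basis ι ℂ E) [FiniteDimensional ℂ E]

/-- The `i`-th complex coordinate, as a real-linear form. -/
def coordR (i : ι) : E →L[ℝ] ℂ := (LinearMap.toContinuousLinearMap (e.coord i)).restrictScalars ℝ

@[simp]
theorem coordR_apply (i : ι) (u : E) : coordR e i u = e.repr u i := rfl

/-- Only the holomorphic half of the exterior algebra is involved; the factors `dz̄ⱼ` are
spectators, which is why `q` plays no role in the `sl₂` argument. -/
theorem isCAR [DecidableEq ι] :
    IsCAR (fun i => totMul (coordR e i)) (fun i => holContract (e i)) where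
  creation i j := totMul_mul _ _
  annihilation i j := by
    have h := anticomm_holPart (A := Module.End ℂ (Tot E)) (totContract_mul (e i) (e j))
      (totContract_mul (e i) (Complex.I • e j)) (totContract_mul (Complex.I • e i) (e j))
      (totContract_mul (Complex.I • e i) (Complex.I • e j))
    exact h
  mixed i j := by
    have hI : coordR e j (Complex.I • e i) = Complex.I * coordR e j (e i) := by
      simp only [coordR_apply, map_smul, Finsupp.smul_apply, smul_eq_mul]
    have h2 := totContract_mul_totMul (Complex.I • e i) (coordR e j)
    rw [hI] at h2
    have h := holPart_mul (A := Module.End ℂ (Tot E))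
      (totContract_mul_totMul (e i) (coordR e j)) h2
    have h' : coordR e j (e i) = if i = j then 1 else 0 := by simp [Finsupp.single_apply]
    rw [h'] at h
    refine h.trans ?_
    split_ifs <;> simp [holContract]

end Operators

/-! ### Types of forms through the infinitesimal circle action -/

section Rotation

variable {E : Type*} [NormedAddCommGroup E] [NormedSpace ℂ E]

/-- The derivation extending multiplication by `i` on tangent vectors. -/
def rotation {k : ℕ} (η : E [⋀^Fin k]→L[ℝ] ℂ) (v : Fin k → E) : ℂ :=
  ∑ r, η (Function.update v r (Complex.I • v r))

theorem hasDerivAt_rotation {k : ℕ} (η : E [⋀^Fin k]→L[ℝ] ℂ) (v : Fin k → E) (t : ℝ) :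
    HasDerivAt (fun t : ℝ => η (fun i => Complex.exp (t * Complex.I) • v i))
      (rotation η (fun i => Complex.exp (t * Complex.I) • v i)) t := by
  have h1 : HasDerivAt (fun t : ℝ => Complex.exp (t * Complex.I))
      (Complex.exp (t * Complex.I) * Complex.I) t := by
    have := ((Complex.ofRealCLM.hasDerivAt (x := t)).mul_const Complex.I).cexp
    simpa using this
  have h2 : HasDerivAt (fun (t : ℝ) (i : Fin k) => Complex.exp (t * Complex.I) • v i)
      (fun i => Complex.I • Complex.exp (t * Complex.I) • v i) t := by
    rw [hasDerivAt_pi]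
    intro i
    have := h1.smul_const (v i)
    rwa [mul_comm, mul_smul] at this
  have h3 := (η.toContinuousMultilinearMap.hasFDerivAt
    (fun i => Complex.exp (t * Complex.I) • v i)).comp_hasDerivAt t h2
  simpa [rotation, ContinuousMultilinearMap.linearDeriv_apply, Function.comp_def] using h3

/-- On the unit circle `cᵖ c̄^q = exp (i t (p - q))`; differentiate at `t = 0`. -/
theorem HasType.rotation_eq {p q : ℕ} {η : E [⋀^Fin (p + q)]→L[ℝ] ℂ} (h : HasType p q η)
    (v : Fin (p + q) → E) : rotation η v = Complex.I * (p - q) * η v := by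
  have h1 := hasDerivAt_rotation η v 0
  have h2 : ∀ t : ℝ, η (fun i => Complex.exp (t * Complex.I) • v i) =
      Complex.exp (t * (Complex.I * (p - q))) * η v := fun t => by
    rw [h, ← Complex.exp_conj, ← Complex.exp_nat_mul, ← Complex.exp_nat_mul, ← Complex.exp_add]
    congr 2
    simp only [map_mul, Complex.conj_I, Complex.conj_ofReal]
    ring
  simp only [h2] at h1
  have h3 : HasDerivAt (fun t : ℝ => Complex.exp (t * (Complex.I * (p - q))) * η v)
      (Complex.I * (p - q) * η v) 0 := by
    have := (((Complex.ofRealCLM.hasDerivAt (x := 0)).mul_const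
      (Complex.I * (p - q))).cexp).mul_const (η v)
    simpa using this
  have := h1.unique h3
  simpa using this

/-- The hypothesis is a linear differential equation along `t ↦ exp (i t) v`, which fixes the action
of the unit circle. Scaling by a real factor `r` gives `r^(p+q)` by multilinearity, and polar
coordinates combine the two. -/
theorem HasType.of_rotation_eq {p q : ℕ} {η : E [⋀^Fin (p + q)]→L[ℝ] ℂ}
    (h : ∀ v, rotation η v = Complex.I * (p - q) * η v) : HasType p q η := by
  intro c v
  have h1 : ∀ t : ℝ, η (fun i => Complex.exp (t * Complex.I) • v i) =
      Complex.exp (t * (Complex.I * (p - q))) * η v := fun t => by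
    let f : ℝ → ℂ := fun t => Complex.exp (-(t * (Complex.I * (p - q)))) *
      η (fun i => Complex.exp (t * Complex.I) • v i)
    have hf : ∀ t, HasDerivAt f 0 t := fun t => by
      have hd := ((((Complex.ofRealCLM.hasDerivAt (x := t)).mul_const
        (Complex.I * (p - q))).neg).cexp).mul (hasDerivAt_rotation η v t)
      rw [h] at hd
      refine hd.congr_deriv ?_
      simp only [Pi.neg_apply, Complex.ofRealCLM_apply, Complex.ofReal_one]
      ring
    have hc : f t = f 0 := is_const_of_deriv_eq_zero (fun t => (hf t).differentiableAt)
      (fun t => (hf t).deriv) t 0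
    simp only [f, Complex.ofReal_zero, zero_mul, neg_zero, Complex.exp_zero, one_mul,
      one_smul] at hc
    rw [← hc, ← mul_assoc, ← Complex.exp_add]
    simp
  have hc : c = (‖c‖ : ℂ) * Complex.exp (c.arg * Complex.I) :=
    (Complex.norm_mul_exp_arg_mul_I c).symm
  have h2 : η (fun i => c • v i) =
      (‖c‖ : ℂ) ^ (p + q) * η (fun i => Complex.exp (c.arg * Complex.I) • v i) := by
    have h3 := η.toContinuousMultilinearMap.map_smul_univ (fun _ => ‖c‖)
      (fun i => Complex.exp (c.arg * Complex.I) • v i)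
    have h4 : ∀ i, c • v i = ‖c‖ • Complex.exp (c.arg * Complex.I) • v i := fun i => by
      conv_lhs => rw [hc]
      rw [mul_smul, Complex.coe_smul]
    simp only [h4]
    simpa using h3
  rw [h2, h1]
  conv_rhs => rw [hc]
  simp only [map_mul, Complex.conj_ofReal, mul_pow, ← Complex.exp_conj, ← Complex.exp_nat_mul]
  have h5 : Complex.exp (c.arg * (Complex.I * (p - q))) =
      Complex.exp (p * (c.arg * Complex.I)) * Complex.exp (q * (c.arg * conj Complex.I)) := by
    rw [← Complex.exp_add]
    congr 1
    simp only [Complex.conj_I]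
    ring
  rw [h5]
  ring

end Rotation

/-! ### Type `(p, q)` as an eigenvalue of the number operator -/

section Types

variable {E : Type*} [NormedAddCommGroup E] [NormedSpace ℂ E] [FiniteDimensional ℂ E]
variable {ι : Type*} [Fintype ι] (e : Module.Basis ι ℂ E)

/-- The operator acting as `p` on forms of type `(p, q)`. -/
def holDegree : Module.End ℂ (Tot E) :=
  IsCAR.number (fun i => totMul (coordR e i)) (fun i => holContract (e i))

theorem holDegree_apply_zero (F : Tot E) : holDegree e F 0 = 0 := by
  simp [holDegree, IsCAR.number]

/-- `N` replaces each argument in turn by its `(1,0)`-part `½ (v_r - i · (i v_r))` and adds up. On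
type `(p, q)` this is `½ ((p + q) + (p - q)) = p`. -/
theorem holDegree_apply_apply (F : Tot E) (k : ℕ) (v : Fin k → E) :
    holDegree e F k v = (1 / 2 : ℂ) * (k * F k v - Complex.I * rotation (F k) v) := by
  cases k with
  | zero => simp [holDegree_apply_zero, rotation]
  | succ k =>
    have h1 : holDegree e F (k + 1) v = ∑ r : Fin (k + 1), (-1) ^ (r : ℕ) •
        holContract (v r) F k (r.removeNth v) := by
      simp only [holDegree, IsCAR.number, LinearMap.sum_apply, Finset.sum_apply,
        ContinuousAlternatingMap.sum_apply, Module.End.mul_apply, totMul_succ, extMul_apply]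
      rw [Finset.sum_comm]
      refine Finset.sum_congr rfl fun r _ => ?_
      rw [← Finset.smul_sum]
      congr 1
      exact sum_coord_mul_holContract e (v r) F k (r.removeNth v)
    have h2 : ∀ (r : Fin (k + 1)) (x : E), (-1) ^ (r : ℕ) • F (k + 1) (Fin.cons x (r.removeNth v)) =
        F (k + 1) (Function.update v r x) := fun r x => by
      have h3 := (F (k + 1)).map_insertNth r x (r.removeNth v)
      have h4 : r.insertNth x (r.removeNth v) = Function.update v r x := by
        rw [Fin.insertNth_removeNth]
      rw [h4] at h3
      exact h3.symm
    rw [h1]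
    simp only [holContract_apply_apply, rotation]
    have h5 : ∀ r : Fin (k + 1), (-1) ^ (r : ℕ) • ((1 / 2 : ℂ) *
        (F (k + 1) (Fin.cons (v r) (r.removeNth v)) -
          Complex.I * F (k + 1) (Fin.cons (Complex.I • v r) (r.removeNth v)))) =
        (1 / 2 : ℂ) * (F (k + 1) v -
          Complex.I * F (k + 1) (Function.update v r (Complex.I • v r))) := fun r => by
      rw [← mul_smul_comm, smul_sub, ← mul_smul_comm, h2, h2, Function.update_eq_self]
    rw [Finset.sum_congr rfl fun r _ => h5 r, ← Finset.mul_sum, Finset.sum_sub_distrib,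
      Finset.mul_sum]
    simp

/-- Turns commutators with `N` into statements about types, and lets the spectral bound on `N` act
on forms of given type. -/
theorem hasType_iff {p q : ℕ} {η : E [⋀^Fin (p + q)]→L[ℝ] ℂ} :
    HasType p q η ↔
      holDegree e (Pi.single (p + q) η) = (p : ℂ) • (Pi.single (p + q) η : Tot E) := by
  have h1 : holDegree e (Pi.single (p + q) η) = (p : ℂ) • (Pi.single (p + q) η : Tot E) ↔
      ∀ v, rotation η v = Complex.I * (p - q) * η v := by
    constructor
    · intro h v
      have h2 := congrArg (fun F : Tot E => F (p + q) v) h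
      simp only [holDegree_apply_apply, Pi.smul_apply, Pi.single_eq_same,
        ContinuousAlternatingMap.smul_apply, smul_eq_mul, Nat.cast_add] at h2
      linear_combination (2 * Complex.I) * h2 + rotation η v * Complex.I_mul_I
    · intro h
      funext k
      ext v
      by_cases hk : k = p + q
      · subst hk
        simp only [holDegree_apply_apply, Pi.smul_apply, Pi.single_eq_same, h,
          ContinuousAlternatingMap.smul_apply, smul_eq_mul, Nat.cast_add]
        linear_combination (-(1 / 2 : ℂ) * (p - q) * η v) * Complex.I_mul_I
      · simp [holDegree_apply_apply, Pi.single_eq_of_ne hk, rotation]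
  rw [h1]
  exact ⟨fun h v => h.rotation_eq v, HasType.of_rotation_eq⟩

end Types

/-! ### Forms of type `(2,0)` as complex bilinear forms -/

section TwoForms

variable {E : Type*} [NormedAddCommGroup E] [NormedSpace ℂ E]

theorem two_form_add_left (s : E [⋀^Fin 2]→L[ℝ] ℂ) (u u' v : E) :
    s ![u + u', v] = s ![u, v] + s ![u', v] :=
  congrArg (fun c => c ![v]) (map_add s.curryLeft u u')

theorem two_form_real_smul_left (s : E [⋀^Fin 2]→L[ℝ] ℂ) (r : ℝ) (u v : E) :
    s ![r • u, v] = r * s ![u, v] := by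
  have h : s ![r • u, v] = r • s ![u, v] :=
    congrArg (fun c => c ![v]) (map_smul s.curryLeft r u)
  rw [h, Complex.real_smul]

theorem two_form_swap (s : E [⋀^Fin 2]→L[ℝ] ℂ) (u v : E) : s ![u, v] = -s ![v, u] :=
  congrArg (fun c => c ![]) (contract_contract v u 0 s)

/-- The type condition only scales both arguments together. Taking `c = 1 + i` polarizes it to
`s(iu, v) + s(u, iv) = 2i s(u, v)`; replacing `u` by `iu` then isolates `s(iu, v)`. -/
theorem HasType.smul_I_left {s : E [⋀^Fin 2]→L[ℝ] ℂ} (hs : HasType 2 0 s) (u v : E) :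
    s ![Complex.I • u, v] = Complex.I * s ![u, v] := by
  have hc : ∀ (c : ℂ) (u v : E), s ![c • u, c • v] = c ^ 2 * s ![u, v] := fun c u v => by
    have h := hs c ![u, v]
    rw [pow_zero, mul_one] at h
    rw [← h]
    congr 1
    funext i
    fin_cases i <;> rfl
  have add_right : ∀ u v v' : E, s ![u, v + v'] = s ![u, v] + s ![u, v'] := fun u v v' => by
    rw [two_form_swap, two_form_add_left, two_form_swap s v, two_form_swap s v']; ring
  have h1 : ∀ u v : E, s ![Complex.I • u, v] + s ![u, Complex.I • v] =
      2 * Complex.I * s ![u, v] := fun u v => by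
    have h := hc (1 + Complex.I) u v
    simp only [add_smul, one_smul, two_form_add_left, add_right, hc] at h
    linear_combination h
  have h2 := h1 (Complex.I • u) v
  rw [smul_smul, Complex.I_mul_I, hc, Complex.I_sq, neg_smul, one_smul] at h2
  have h3 : s ![-u, v] = -s ![u, v] := by
    simpa using two_form_real_smul_left s (-1) u v
  rw [h3] at h2
  linear_combination (Complex.I / 2) * h2 + s ![Complex.I • u, v] * Complex.I_mul_I

theorem HasType.smul_left {s : E [⋀^Fin 2]→L[ℝ] ℂ} (hs : HasType 2 0 s) (c : ℂ) (u v : E) :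
    s ![c • u, v] = c * s ![u, v] := by
  have h : c • u = c.re • u + c.im • (Complex.I • u) := by
    conv_lhs => rw [← Complex.re_add_im c]
    rw [add_smul, mul_smul, Complex.coe_smul, Complex.coe_smul]
  rw [h, two_form_add_left, two_form_real_smul_left, two_form_real_smul_left, hs.smul_I_left]
  conv_rhs => rw [← Complex.re_add_im c]
  ring

/-- A `(2,0)`-form as a complex bilinear form. -/
def HasType.bilin {s : E [⋀^Fin 2]→L[ℝ] ℂ} (hs : HasType 2 0 s) : E →ₗ[ℂ] E →ₗ[ℂ] ℂ :=
  LinearMap.mk₂ ℂ (fun u v => s ![u, v]) (two_form_add_left s) (hs.smul_left)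
    (fun u v v' => by
      rw [two_form_swap, two_form_add_left, two_form_swap s v, two_form_swap s v']; ring)
    (fun c u v => by
      rw [two_form_swap, hs.smul_left, two_form_swap s v, smul_eq_mul]; ring)

@[simp]
theorem HasType.bilin_apply {s : E [⋀^Fin 2]→L[ℝ] ℂ} (hs : HasType 2 0 s) (u v : E) :
    hs.bilin u v = s ![u, v] := rfl

/-- The matrix of a `2`-form in a complex basis. -/
def formMatrix {ι : Type*} (e : Module.Basis ι ℂ E) (s : E [⋀^Fin 2]→L[ℝ] ℂ) : Matrix ι ι ℂ :=
  fun i j => s ![e i, e j]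

theorem formMatrix_swap {ι : Type*} (e : Module.Basis ι ℂ E) (s : E [⋀^Fin 2]→L[ℝ] ℂ) (i j : ι) :
    formMatrix e s j i = -formMatrix e s i j := two_form_swap _ _ _

variable {ι : Type*} [Fintype ι] (e : Module.Basis ι ℂ E)

theorem HasType.sum_formMatrix {s : E [⋀^Fin 2]→L[ℝ] ℂ} (hs : HasType 2 0 s) (u v : E) :
    ∑ i, ∑ j, formMatrix e s i j * (e.repr u i * e.repr v j) = s ![u, v] := by
  have h := hs.bilin_apply u v
  rw [← h]
  conv_rhs => rw [← e.sum_repr u, ← e.sum_repr v]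
  simp only [map_sum, map_smul, LinearMap.sum_apply, LinearMap.smul_apply, smul_eq_mul,
    HasType.bilin_apply, formMatrix, Finset.mul_sum]
  rw [Finset.sum_comm]
  refine Finset.sum_congr rfl fun i _ => Finset.sum_congr rfl fun j _ => by ring

theorem HasType.isUnit_det_formMatrix [DecidableEq ι] {s : E [⋀^Fin 2]→L[ℝ] ℂ}
    (hs : HasType 2 0 s) (hnd : ∀ u : E, (∀ v : E, s ![u, v] = 0) → u = 0) :
    IsUnit (formMatrix e s).det := by
  rw [isUnit_iff_ne_zero]
  intro hdet
  obtain ⟨c, hc, hcs⟩ := Matrix.exists_vecMul_eq_zero_iff.2 hdet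
  have hu : ∑ i, c i • e i = 0 := by
    refine hnd _ fun v => ?_
    rw [← hs.bilin_apply, map_sum, ← e.sum_repr v]
    simp only [map_sum, map_smul, LinearMap.sum_apply, LinearMap.smul_apply, smul_eq_mul,
      HasType.bilin_apply]
    rw [Finset.sum_eq_zero]
    intro j _
    have h := congrFun hcs j
    simp only [Matrix.vecMul, dotProduct, formMatrix, Pi.zero_apply] at h
    rw [h, mul_zero]
  exact hc (funext fun i => Fintype.linearIndependent_iff.1 e.linearIndependent c hu i)

end TwoForms

/-! ### The pointwise Lefschetz isomorphism -/

section Lefschetz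

variable {E : Type*} [NormedAddCommGroup E] [NormedSpace ℂ E]

/-- The wedge product as a bilinear map. -/
def wedgeBilin (E : Type*) [NormedAddCommGroup E] [NormedSpace ℂ E] (k l : ℕ) :
    (E [⋀^Fin k]→L[ℝ] ℂ) →ₗ[ℂ] (E [⋀^Fin l]→L[ℝ] ℂ) →ₗ[ℂ] E [⋀^Fin (k + l)]→L[ℝ] ℂ :=
  LinearMap.mk₂ ℂ wedge add_wedge smul_wedge wedge_add wedge_smul

theorem extMul_wedge (θ : E →L[ℝ] ℂ)
    {k l : ℕ} (a : E [⋀^Fin k]→L[ℝ] ℂ) (b : E [⋀^Fin l]→L[ℝ] ℂ) :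
    wedge (extMul θ k a) b = castDeg (by omega) (extMul θ (k + l) (wedge a b)) :=
  wedge_alternatizeUncurryFin _ _ (θ.smulRight (wedge a b)) fun u => by
    simp [smul_wedge]

theorem single_castDeg {k l : ℕ}
    (h : k = l) (a : E [⋀^Fin k]→L[ℝ] ℂ) :
    (Pi.single l (castDeg h a) : Tot E) = Pi.single k a := by
  subst h; rfl

theorem totMul_single (θ : E →L[ℝ] ℂ)
    (k : ℕ) (a : E [⋀^Fin k]→L[ℝ] ℂ) :
    totMul θ (Pi.single k a) = Pi.single (k + 1) (extMul θ k a) := by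
  funext j
  cases j with
  | zero => rw [Pi.single_eq_of_ne (by omega)]; rfl
  | succ j =>
    rw [totMul_succ]
    by_cases h : j = k
    · subst h; simp
    · rw [Pi.single_eq_of_ne h, Pi.single_eq_of_ne (by omega), map_zero]

theorem single_sum {κ : Type*} (u : Finset κ)
    (k : ℕ) (f : κ → E [⋀^Fin k]→L[ℝ] ℂ) :
    (Pi.single k (∑ i ∈ u, f i) : Tot E) = ∑ i ∈ u, Pi.single k (f i) :=
  map_sum (LinearMap.single ℂ (fun k : ℕ => E [⋀^Fin k]→L[ℝ] ℂ) k) f u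

theorem single_smul
    (k : ℕ) (c : ℂ) (a : E [⋀^Fin k]→L[ℝ] ℂ) :
    (Pi.single k (c • a) : Tot E) = c • Pi.single k a :=
  map_smul (LinearMap.single ℂ (fun k : ℕ => E [⋀^Fin k]→L[ℝ] ℂ) k) c a

/-- The interior product with the `(1,0)`-part of `u`, in a given degree. -/
def holContractDeg (u : E) (k : ℕ) :
    (E [⋀^Fin (k + 1)]→L[ℝ] ℂ) →ₗ[ℂ] E [⋀^Fin k]→L[ℝ] ℂ :=
  (1 / 2 : ℂ) • (contract u k - Complex.I • contract (Complex.I • u) k)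

theorem holContract_single (u : E) (k : ℕ)
    (a : E [⋀^Fin (k + 1)]→L[ℝ] ℂ) :
    holContract u (Pi.single (k + 1) a) = Pi.single k (holContractDeg u k a) := by
  funext j
  have h : ∀ F : Tot E, holContract u F j = holContractDeg u j (F (j + 1)) := fun F => by
    simp [holContract, holContractDeg]
  rw [h]
  by_cases hj : j = k
  · subst hj; simp
  · rw [Pi.single_eq_of_ne hj, Pi.single_eq_of_ne (by omega), map_zero]

variable {ι : Type*} [Fintype ι] (e : Module.Basis ι ℂ E)

/-- The dual Lefschetz operator of a matrix on forms of all degrees. -/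
def totLower (t : Matrix ι ι ℂ) : Module.End ℂ (Tot E) :=
  IsCAR.quad t fun i => holContract (e i)

/-- The dual Lefschetz operator of a matrix in a given degree. -/
def lower (t : Matrix ι ι ℂ) (k : ℕ) (b : E [⋀^Fin (k + 2)]→L[ℝ] ℂ) : E [⋀^Fin k]→L[ℝ] ℂ :=
  (1 / 2 : ℂ) • ∑ i, ∑ j, t i j • holContractDeg (e i) k (holContractDeg (e j) (k + 1) b)

theorem totLower_single (t : Matrix ι ι ℂ) (k : ℕ) (b : E [⋀^Fin (k + 2)]→L[ℝ] ℂ) :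
    totLower e t (Pi.single (k + 2) b) = Pi.single k (lower e t k b) := by
  rw [lower, single_smul, single_sum]
  simp only [single_sum, single_smul, totLower, IsCAR.quad, LinearMap.smul_apply,
    LinearMap.sum_apply, Module.End.mul_apply, holContract_single]

/-- The iterated dual Lefschetz operator. -/
def lowerPow (t : Matrix ι ι ℂ) (k : ℕ) :
    (m : ℕ) → (E [⋀^Fin (k + 2 * m)]→L[ℝ] ℂ) → E [⋀^Fin k]→L[ℝ] ℂ
  | 0 => id
  | m + 1 => fun b => lowerPow t k m (lower e t (k + 2 * m) b)

theorem single_lowerPow (t : Matrix ι ι ℂ) (k m : ℕ) (b : E [⋀^Fin (k + 2 * m)]→L[ℝ] ℂ) :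
    (Pi.single k (lowerPow e t k m b) : Tot E) = (totLower e t ^ m) (Pi.single (k + 2 * m) b) := by
  induction m with
  | zero => rfl
  | succ m ih =>
    rw [lowerPow, ih, pow_succ, Module.End.mul_apply]
    congr 1
    exact (totLower_single e t (k + 2 * m) b).symm

variable [FiniteDimensional ℂ E]

/-- The exterior multiplication by `½ ∑ sᵢⱼ eⁱ ∧ eʲ`. -/
def raise (s : Matrix ι ι ℂ) (l : ℕ) (b : E [⋀^Fin l]→L[ℝ] ℂ) : E [⋀^Fin (l + 2)]→L[ℝ] ℂ :=
  (1 / 2 : ℂ) • ∑ i, ∑ j, s i j • extMul (coordR e i) (l + 1) (extMul (coordR e j) l b)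

/-- The case `b = 1` is the expansion `s = ½ ∑ sᵢⱼ eⁱ ∧ eʲ`, valid because `s` is complex bilinear;
the general case follows by wedging with `b` on the right. -/
theorem HasType.wedge_eq_raise {s : E [⋀^Fin 2]→L[ℝ] ℂ} (hs : HasType 2 0 s) {l : ℕ}
    (b : E [⋀^Fin l]→L[ℝ] ℂ) :
    wedge s b = castDeg (add_comm l 2) (raise e (formMatrix e s) l b) := by
  let one : E [⋀^Fin 0]→L[ℝ] ℂ := ContinuousAlternatingMap.constOfIsEmpty ℝ E (Fin 0) 1
  have h1 : s = raise e (formMatrix e s) 0 one := by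
    ext v
    have hv : v = ![v 0, v 1] := by
      funext i; fin_cases i <;> rfl
    have h2 : raise e (formMatrix e s) 0 one v = (1 / 2 : ℂ) *
        (∑ i, ∑ j, formMatrix e s i j * (e.repr (v 0) i * e.repr (v 1) j) -
          ∑ i, ∑ j, formMatrix e s i j * (e.repr (v 1) i * e.repr (v 0) j)) := by
      simp only [raise, ContinuousAlternatingMap.smul_apply,
        ContinuousAlternatingMap.sum_apply, extMul_apply, ← Finset.sum_sub_distrib, ← mul_sub]
      simp [Fin.sum_univ_succ, one, Fin.removeNth, sub_eq_add_neg]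
    rw [h2, hs.sum_formMatrix, hs.sum_formMatrix, two_form_swap s (v 1), ← hv]
    ring
  have h3 : ∀ i j, wedge (extMul (coordR e i) 1 (extMul (coordR e j) 0 one)) b =
      castDeg (add_comm l 2) (extMul (coordR e i) (l + 1) (extMul (coordR e j) l b)) :=
    fun i j => by
      have h4 : ∀ {k k' : ℕ} (h : k = k') (θ : E →L[ℝ] ℂ) (a : E [⋀^Fin k]→L[ℝ] ℂ),
          extMul θ k' (castDeg h a) = castDeg (by rw [h]) (extMul θ k a) := by
        intro k k' h θ a; subst h; rfl
      rw [extMul_wedge, extMul_wedge, wedge_of_degree_zero]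
      have h5 : (one 0 : ℂ) = 1 := rfl
      rw [h5, one_smul, h4, castDeg_castDeg, h4, h4]
      simp only [castDeg_castDeg]
  have h6 : ∀ (x : E [⋀^Fin 2]→L[ℝ] ℂ), wedge x b = wedgeBilin E 2 l x b := fun _ => rfl
  let C : (E [⋀^Fin (l + 2)]→L[ℝ] ℂ) →ₗ[ℂ] E [⋀^Fin (2 + l)]→L[ℝ] ℂ :=
    { toFun := castDeg (add_comm l 2)
      map_add' := castDeg_add _
      map_smul' := castDeg_smul _ }
  have h7 : ∀ x, castDeg (add_comm l 2) x = C x := fun _ => rfl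
  conv_lhs => rw [h1]
  simp only [h6, h7, raise, map_smul, map_sum, LinearMap.smul_apply, LinearMap.sum_apply] at h3 ⊢
  simp only [h3]

/-- The Lefschetz operator of a matrix on forms of all degrees. -/
def totRaise (s : Matrix ι ι ℂ) : Module.End ℂ (Tot E) :=
  IsCAR.quad s fun i => totMul (coordR e i)

theorem totRaise_single (s : Matrix ι ι ℂ) (l : ℕ) (b : E [⋀^Fin l]→L[ℝ] ℂ) :
    totRaise e s (Pi.single l b) = Pi.single (l + 2) (raise e s l b) := by
  rw [raise, single_smul, single_sum]
  simp only [single_sum, single_smul, totRaise, IsCAR.quad, LinearMap.smul_apply,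
    LinearMap.sum_apply, Module.End.mul_apply, totMul_single]

theorem HasType.single_wedge {s : E [⋀^Fin 2]→L[ℝ] ℂ} (hs : HasType 2 0 s) {l : ℕ}
    (b : E [⋀^Fin l]→L[ℝ] ℂ) :
    (Pi.single (2 + l) (wedge s b) : Tot E) = totRaise e (formMatrix e s) (Pi.single l b) := by
  rw [hs.wedge_eq_raise e, single_castDeg, totRaise_single]

/-- `wedgePow` adds its new factor on the right, so associativity alone brings it next to `b`;
`2`-forms need not be commuted. -/
theorem HasType.single_wedgePow {s : E [⋀^Fin 2]→L[ℝ] ℂ} (hs : HasType 2 0 s) (m : ℕ) {l : ℕ}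
    (b : E [⋀^Fin l]→L[ℝ] ℂ) :
    (Pi.single (2 * m + l) (wedge (wedgePow s m) b) : Tot E) =
      (totRaise e (formMatrix e s) ^ m) (Pi.single l b) := by
  induction m generalizing l with
  | zero =>
    rw [wedge_of_degree_zero, single_castDeg, pow_zero]
    simp [wedgePow]
  | succ m ih =>
    have h : wedge (wedgePow s (m + 1)) b = castDeg (by omega)
        (wedge (wedgePow s m) (wedge s b)) := wedge_assoc _ _ _
    rw [h, single_castDeg, ih, hs.single_wedge e, pow_succ, Module.End.mul_apply]

variable {s : E [⋀^Fin 2]→L[ℝ] ℂ}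

theorem holDegree_mul_totRaise (S : Matrix ι ι ℂ) :
    holDegree e * totRaise e S = totRaise e S * holDegree e + (2 : ℂ) • totRaise e S := by
  classical
  exact (isCAR e).number_mul_quad_creation S

theorem holDegree_mul_totLower (S : Matrix ι ι ℂ) :
    holDegree e * totLower e S = totLower e S * holDegree e - (2 : ℂ) • totLower e S := by
  classical
  exact (isCAR e).number_mul_quad_annihilation S

theorem HasType.wedgePow_wedge (hs : HasType 2 0 s) (m : ℕ) {p q r : ℕ} (hp : 2 * m + p = r)
    {a : E [⋀^Fin (p + q)]→L[ℝ] ℂ} (ha : HasType p q a) (h : 2 * m + (p + q) = r + q) :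
    HasType r q (castDeg h (wedge (wedgePow s m) a)) := by
  let e := Module.finBasis ℂ E
  rw [hasType_iff e, single_castDeg, hs.single_wedgePow e,
    pow_eigenvector (holDegree_mul_totRaise e _) ((hasType_iff e).1 ha)]
  congr 1
  rw [← hp]
  push_cast
  ring


theorem hasType_lowerPow (t : Matrix ι ι ℂ) {m p q : ℕ} (hp : p = 1 + 2 * m)
    {b : E [⋀^Fin (p + q)]→L[ℝ] ℂ} (hb : HasType p q b) (h : p + q = 1 + q + 2 * m) :
    HasType 1 q (lowerPow e t (1 + q) m (castDeg h b)) := by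
  have hN : holDegree e * totLower e t = totLower e t * holDegree e + (-2 : ℂ) • totLower e t :=
    lowering_commutator (holDegree_mul_totLower e t)
  rw [hasType_iff e, single_lowerPow, single_castDeg,
    pow_eigenvector hN ((hasType_iff e).1 hb)]
  congr 1
  rw [hp]
  push_cast
  ring

variable [DecidableEq ι]

theorem HasType.lowerPow_wedgePow (hs : HasType 2 0 s)
    (hnd : ∀ u : E, (∀ v : E, s ![u, v] = 0) → u = 0) {n m : ℕ}
    (hn : Fintype.card ι = 2 * n) {q : ℕ} {a : E [⋀^Fin (1 + q)]→L[ℝ] ℂ} (ha : HasType 1 q a)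
    (h : 2 * m + (1 + q) = 1 + q + 2 * m) :
    lowerPow e (formMatrix e s)⁻¹ (1 + q) m (castDeg h (wedge (wedgePow s m) a)) =
      lefschetzConst n m • a := by
  have hunit := hs.isUnit_det_formMatrix e hnd
  have ha1 := (hasType_iff e).1 ha
  rw [Nat.cast_one] at ha1
  -- Lowering from `N = 1` would give `N = -1`, outside the spectrum.
  have hK : totLower e (formMatrix e s)⁻¹ (Pi.single (1 + q) a) = 0 := by
    refine (isCAR e).eq_zero_of_number (c := -1) (fun k _ hk => ?_) ?_
    · have : (k : ℂ) + 1 = 0 := by rw [← hk]; ring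
      exact absurd this (by exact_mod_cast k.succ_ne_zero)
    · have := LinearMap.congr_fun (holDegree_mul_totLower e (formMatrix e s)⁻¹)
        (Pi.single (1 + q) a)
      simp only [Module.End.mul_apply, LinearMap.sub_apply, LinearMap.smul_apply, ha1,
        map_smul] at this
      refine this.trans ?_
      module
  have h1 := lowering_pow_raising_pow (n := n) ((isCAR e).quad_commutator
    (fun i j => formMatrix_swap e s i j) (Matrix.nonsing_inv_mul _ hunit) hn)
    (holDegree_mul_totRaise e _) ha1 hK m
  apply Pi.single_injective (M := fun k : ℕ => E [⋀^Fin k]→L[ℝ] ℂ) (1 + q)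
  rw [single_lowerPow, single_castDeg, hs.single_wedgePow e, single_smul]
  exact h1

theorem HasType.wedgePow_lowerPow (hs : HasType 2 0 s)
    (hnd : ∀ u : E, (∀ v : E, s ![u, v] = 0) → u = 0) {n m : ℕ}
    (hn : Fintype.card ι = 2 * n) {p q : ℕ} (hp : p + 1 = 2 * n)
    {b : E [⋀^Fin (p + q)]→L[ℝ] ℂ} (hb : HasType p q b)
    (h : p + q = 1 + q + 2 * m) (h' : 2 * m + (1 + q) = p + q) :
    castDeg h' (wedge (wedgePow s m) (lowerPow e (formMatrix e s)⁻¹ (1 + q) m (castDeg h b))) =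
      lefschetzConst n m • b := by
  have hunit := hs.isUnit_det_formMatrix e hnd
  have hb1 := (hasType_iff e).1 hb
  have hpc : (p : ℂ) = 2 * n - 1 := by
    have : (p : ℂ) + 1 = 2 * n := by exact_mod_cast hp
    linear_combination this
  rw [hpc] at hb1
  -- Raising from `N = 2n - 1` would give `N = 2n + 1`, above the complex dimension `2n`.
  have hL : totRaise e (formMatrix e s) (Pi.single (p + q) b) = 0 := by
    refine (isCAR e).eq_zero_of_number (c := 2 * n + 1) (fun k hk hk' => ?_) ?_
    · have : 2 * n + 1 = k := by exact_mod_cast hk'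
      omega
    · have := LinearMap.congr_fun (holDegree_mul_totRaise e (formMatrix e s))
        (Pi.single (p + q) b)
      simp only [Module.End.mul_apply, LinearMap.add_apply, LinearMap.smul_apply, hb1,
        map_smul] at this
      refine this.trans ?_
      module
  have h1 := raising_pow_lowering_pow (n := n) ((isCAR e).quad_commutator
    (fun i j => formMatrix_swap e s i j) (Matrix.nonsing_inv_mul _ hunit) hn)
    (holDegree_mul_totLower e _) hb1 hL m
  apply Pi.single_injective (M := fun k : ℕ => E [⋀^Fin k]→L[ℝ] ℂ) (p + q)
  rw [single_castDeg, hs.single_wedgePow e, single_lowerPow, single_castDeg, single_smul]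
  exact h1

end Lefschetz

/-! ### Types of derivatives and the Leibniz rule for `∂̄` -/

section Calculus

variable {E : Type*} [NormedAddCommGroup E] [NormedSpace ℂ E]

theorem antilinearPart_apply {F : Type*} [NormedAddCommGroup F] [NormedSpace ℂ F] (D : E →L[ℝ] F)
    (u : E) : antilinearPart D u = (1 / 2 : ℂ) • (D u + Complex.I • D (Complex.I • u)) := rfl

theorem antilinearPart_smul_apply {F : Type*} [NormedAddCommGroup F] [NormedSpace ℂ F]
    (D : E →L[ℝ] F) (c : ℂ) (u : E) :
    antilinearPart D (c • u) = conj c • antilinearPart D u := by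
  have h : c • u = c.re • u + c.im • (Complex.I • u) := by
    conv_lhs => rw [← Complex.re_add_im c]
    rw [add_smul, mul_smul, Complex.coe_smul, Complex.coe_smul]
  have h' : Complex.I • (c • u) = c.re • (Complex.I • u) + (-c.im) • u := by
    rw [h, smul_add, smul_comm Complex.I, smul_comm Complex.I c.im, smul_smul, Complex.I_mul_I]
    simp
  have hD : ∀ (r : ℝ) (x : E), D (r • x) = (r : ℂ) • D x := fun r x => by
    rw [map_smul, Complex.coe_smul]
  have hc : conj c = (c.re : ℂ) - c.im * Complex.I := Complex.ext (by simp) (by simp)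
  rw [antilinearPart_apply, h', h, antilinearPart_apply, map_add, map_add, hD, hD, hD, hD, hc]
  simp only [Complex.ofReal_neg]
  match_scalars
  · ring
  · linear_combination (1 / 2 * c.im : ℂ) * Complex.I_mul_I

theorem HasType.add {p q : ℕ} {a b : E [⋀^Fin (p + q)]→L[ℝ] ℂ} (ha : HasType p q a)
    (hb : HasType p q b) : HasType p q (a + b) := fun c v => by
  simp [ha c v, hb c v, mul_add]

theorem HasType.smul {p q : ℕ} {a : E [⋀^Fin (p + q)]→L[ℝ] ℂ} (z : ℂ) (ha : HasType p q a) :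
    HasType p q (z • a) := fun c v => by
  simp [ha c v, mul_left_comm]

theorem hasType_fderiv {p q : ℕ} {a : E → E [⋀^Fin (p + q)]→L[ℝ] ℂ} {y : E}
    (ha : DifferentiableAt ℝ a y) (ht : ∀ᶠ z in nhds y, HasType p q (a z)) (u : E) :
    HasType p q (fderiv ℝ a y u) := fun c v => by
  have h : ∀ w : Fin (p + q) → E, HasFDerivAt (fun z => a z w)
      ((ContinuousAlternatingMap.apply ℝ E ℂ w).comp (fderiv ℝ a y)) y := fun w =>
    (ContinuousAlternatingMap.apply ℝ E ℂ w).hasFDerivAt.comp y ha.hasFDerivAt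
  have h1 := h (fun i => c • v i)
  have h2 := (h v).const_mul (c ^ p * conj c ^ q)
  have h3 := h2.congr_of_eventuallyEq (ht.mono fun z hz => hz c v)
  have h4 := congrArg (fun D => D u) (h1.unique h3)
  exact h4

/-- The coefficients keep type `(p, q)` after differentiation, and the new slot is antilinear,
contributing one more `c̄`. -/
theorem hasType_dbarFlat {p q : ℕ} {a : E → E [⋀^Fin (p + q)]→L[ℝ] ℂ} {y : E}
    (ha : DifferentiableAt ℝ a y) (ht : ∀ᶠ z in nhds y, HasType p q (a z)) :
    HasType p (q + 1) (dbarFlat a y) := fun c v => by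
  have h1 : ∀ u, HasType p q (antilinearPart (fderiv ℝ a y) u) := fun u =>
    ((hasType_fderiv ha ht u).add ((hasType_fderiv ha ht _).smul _)).smul _
  simp only [dbarFlat]
  refine (ContinuousAlternatingMap.alternatizeUncurryFin_apply _ _).trans ?_
  refine Eq.trans ?_ (congrArg (_ * ·)
    (ContinuousAlternatingMap.alternatizeUncurryFin_apply _ _).symm)
  rw [Finset.mul_sum]
  refine Finset.sum_congr rfl fun i _ => ?_
  have h2 := h1 (v i) c (i.removeNth v)
  rw [antilinearPart_smul_apply, ContinuousAlternatingMap.smul_apply]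
  refine (congrArg (fun x => (-1) ^ (i : ℕ) • conj c • x) h2).trans ?_
  rw [mul_smul_comm]
  congr 1
  rw [smul_eq_mul]
  ring

/-- Under `v ↦ i v` the `(p+1, q)`- and `(p, q+1)`-parts of `da` are multiplied by `z i` and `-z i`,
where `z = iᵖ (-i)^q`. So `da(iv) = z i da(v) - 2 z i ∂̄a(v)`, which isolates `∂̄a`. -/
theorem dbarFlat_eq_zero_of_extDeriv {p q : ℕ} {a : E → E [⋀^Fin (p + q)]→L[ℝ] ℂ} {y : E}
    (ha : DifferentiableAt ℝ a y) (ht : ∀ᶠ z in nhds y, HasType p q (a z))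
    (hd : extDeriv a y = 0) : dbarFlat a y = 0 := by
  ext v
  have hD := hasType_fderiv ha ht
  have hlin : ∀ u, fderiv ℝ a y (Complex.I • u) =
      Complex.I • fderiv ℝ a y u - (2 * Complex.I) • antilinearPart (fderiv ℝ a y) u := fun u => by
    rw [antilinearPart_apply]
    match_scalars
    · linear_combination Complex.I_mul_I
    · ring
  have hA := congrArg (fun η => η (fun i => Complex.I • v i)) hd
  have hA0 := congrArg (fun η => η v) hd
  simp only [extDeriv, ContinuousAlternatingMap.alternatizeUncurryFin_apply] at hA hA0
  change _ = (0 : ℂ) at hA hA0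
  have h3 : ∀ i : Fin (p + q + 1), i.removeNth (fun j => Complex.I • v j) =
      fun j => Complex.I • i.removeNth v j := fun i => rfl
  set z : ℂ := Complex.I ^ p * conj Complex.I ^ q with hz
  have hz0 : z ≠ 0 := by simp [hz]
  have h4 : ∀ i : Fin (p + q + 1), (-1) ^ (i : ℕ) •
      fderiv ℝ a y (Complex.I • v i) (i.removeNth fun j => Complex.I • v j) =
      (z * Complex.I) * ((-1) ^ (i : ℕ) • fderiv ℝ a y (v i) (i.removeNth v)) -
      (z * (2 * Complex.I)) * ((-1) ^ (i : ℕ) •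
        antilinearPart (fderiv ℝ a y) (v i) (i.removeNth v)) := fun i => by
    rw [h3, hD _ Complex.I (i.removeNth v), hlin, ContinuousAlternatingMap.sub_apply,
      ContinuousAlternatingMap.smul_apply, ContinuousAlternatingMap.smul_apply,
      mul_smul_comm, mul_smul_comm, ← smul_sub, smul_eq_mul, smul_eq_mul]
    congr 1
    ring
  rw [Finset.sum_congr rfl fun i _ => h4 i, Finset.sum_sub_distrib, ← Finset.mul_sum,
    ← Finset.mul_sum, hA0, mul_zero, zero_sub, neg_eq_zero,
    ← ContinuousAlternatingMap.alternatizeUncurryFin_apply] at hA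
  exact (mul_eq_zero.1 hA).resolve_left (by simp [hz0])

theorem dbarFlat_castDeg {k l : ℕ} (h : k = l) (a : E → E [⋀^Fin k]→L[ℝ] ℂ) (y : E) :
    dbarFlat (fun z => castDeg h (a z)) y = castDeg (by rw [h]) (dbarFlat a y) := by
  subst h; rfl

theorem contDiffOn_castDeg {k l : ℕ} (h : k = l) {a : E → E [⋀^Fin k]→L[ℝ] ℂ} {U : Set E}
    (ha : ContDiffOn ℝ ∞ a U) : ContDiffOn ℝ ∞ (fun z => castDeg h (a z)) U := by
  subst h; exact ha

theorem contDiffOn_bilinear {V F G H : Type*} [NormedAddCommGroup V] [NormedSpace ℝ V]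
    [NormedAddCommGroup F] [NormedSpace ℝ F] [NormedAddCommGroup G] [NormedSpace ℝ G]
    [NormedAddCommGroup H] [NormedSpace ℝ H] (B : F →L[ℝ] G →L[ℝ] H) {f : V → F} {g : V → G}
    {U : Set V} (hf : ContDiffOn ℝ ∞ f U) (hg : ContDiffOn ℝ ∞ g U) :
    ContDiffOn ℝ ∞ (fun z => B (f z) (g z)) U :=
  (B.contDiff.comp_contDiffOn hf).clm_apply hg

variable [FiniteDimensional ℂ E]

/-- Makes the algebraic operations on forms automatically continuous, so that they can be
differentiated. -/
theorem finite_forms (k : ℕ) : FiniteDimensional ℝ (E [⋀^Fin k]→L[ℝ] ℂ) := by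
  have : FiniteDimensional ℝ E := FiniteDimensional.complexToReal E
  let f : (E [⋀^Fin k]→L[ℝ] ℂ) →ₗ[ℝ] MultilinearMap ℝ (fun _ : Fin k => E) ℂ :=
    { toFun a := a.toMultilinearMap
      map_add' _ _ := rfl
      map_smul' _ _ := rfl }
  refine Module.Finite.of_injective f fun a b h => ?_
  ext v
  exact congrArg (fun m => m v) h

/-- The wedge product as a continuous real-bilinear map. -/
def wedgeCLM (E : Type*) [NormedAddCommGroup E] [NormedSpace ℂ E] [FiniteDimensional ℂ E]
    (k l : ℕ) :
    (E [⋀^Fin k]→L[ℝ] ℂ) →L[ℝ] (E [⋀^Fin l]→L[ℝ] ℂ) →L[ℝ] E [⋀^Fin (k + l)]→L[ℝ] ℂ :=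
  haveI := finite_forms (E := E) k
  haveI := finite_forms (E := E) l
  LinearMap.toContinuousBilinearMap ((wedgeBilin E k l).restrictScalars₁₂ ℝ ℝ)

@[simp]
theorem wedgeCLM_apply {k l : ℕ} (a : E [⋀^Fin k]→L[ℝ] ℂ) (b : E [⋀^Fin l]→L[ℝ] ℂ) :
    wedgeCLM E k l a b = wedge a b := rfl

/-- Exterior multiplication by a `1`-form as a continuous real-linear map. -/
def extMulCLM (θ : E →L[ℝ] ℂ) (k : ℕ) :
    (E [⋀^Fin k]→L[ℝ] ℂ) →L[ℝ] E [⋀^Fin (k + 1)]→L[ℝ] ℂ :=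
  haveI := finite_forms (E := E) k
  LinearMap.toContinuousLinearMap ((extMul θ k).restrictScalars ℝ)

@[simp]
theorem extMulCLM_apply (θ : E →L[ℝ] ℂ) (k : ℕ) (b : E [⋀^Fin k]→L[ℝ] ℂ) :
    extMulCLM θ k b = extMul θ k b := rfl

/-- Expand `s` into products of two `1`-forms: the derivative slot passes each with a sign `-1`, and
the two signs cancel. -/
theorem alternatizeUncurryFin_wedge {s : E [⋀^Fin 2]→L[ℝ] ℂ} (hs : HasType 2 0 s) {k : ℕ}
    (g : E →L[ℝ] E [⋀^Fin k]→L[ℝ] ℂ) (g' : E →L[ℝ] E [⋀^Fin (2 + k)]→L[ℝ] ℂ)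
    (hg : ∀ u, g' u = wedge s (g u)) :
    ContinuousAlternatingMap.alternatizeUncurryFin g' =
      castDeg (add_assoc 2 k 1).symm (wedge s (.alternatizeUncurryFin g)) := by
  let e := Module.finBasis ℂ E
  let G := fun i j => (extMulCLM (coordR e i) (k + 1) ∘L extMulCLM (coordR e j) k) ∘L g
  have hG : ∀ i j, ContinuousAlternatingMap.alternatizeUncurryFin (G i j) =
      extMul (coordR e i) (k + 2) (extMul (coordR e j) (k + 1) (.alternatizeUncurryFin g)) :=
    fun i j => by
      rw [alternatizeUncurryFin_extMul (coordR e i) (k + 1) (extMulCLM (coordR e j) k ∘L g) (G i j)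
        fun u => rfl, alternatizeUncurryFin_extMul (coordR e j) k g _ fun u => rfl, map_neg,
        neg_neg]
  let g'' : E →L[ℝ] E [⋀^Fin (k + 2)]→L[ℝ] ℂ :=
    (1 / 2 : ℂ) • ∑ i, ∑ j, formMatrix e s i j • G i j
  rw [alternatizeUncurryFin_castDeg (add_comm k 2) g'' g' fun u => ?_]
  · rw [hs.wedge_eq_raise e, castDeg_castDeg]
    congr 1
    simp only [g'', raise, ContinuousAlternatingMap.alternatizeUncurryFin_smul]
    simp only [← ContinuousAlternatingMap.alternatizeUncurryFinCLM_apply, map_sum]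
    simp only [ContinuousAlternatingMap.alternatizeUncurryFinCLM_apply,
      ContinuousAlternatingMap.alternatizeUncurryFin_smul, hG]
  · rw [hg, hs.wedge_eq_raise e]
    congr 1
    simp [g'', raise, G]

theorem differentiableAt_wedge {k l : ℕ} {a : E → E [⋀^Fin k]→L[ℝ] ℂ}
    {b : E → E [⋀^Fin l]→L[ℝ] ℂ} {y : E} (ha : DifferentiableAt ℝ a y)
    (hb : DifferentiableAt ℝ b y) :
    DifferentiableAt ℝ (fun z => wedge (a z) (b z)) y :=
  ((wedgeCLM E k l).hasFDerivAt_of_bilinear ha.hasFDerivAt hb.hasFDerivAt).differentiableAt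

theorem contDiffOn_wedge {k l : ℕ} {a : E → E [⋀^Fin k]→L[ℝ] ℂ}
    {b : E → E [⋀^Fin l]→L[ℝ] ℂ} {U : Set E} (ha : ContDiffOn ℝ ∞ a U)
    (hb : ContDiffOn ℝ ∞ b U) :
    ContDiffOn ℝ ∞ (fun z => wedge (a z) (b z)) U :=
  contDiffOn_bilinear (wedgeCLM E k l) ha hb

theorem contDiffOn_wedgePow {s : E → E [⋀^Fin 2]→L[ℝ] ℂ} {U : Set E} (hs : ContDiffOn ℝ ∞ s U)
    (m : ℕ) : ContDiffOn ℝ ∞ (fun z => wedgePow (s z) m) U := by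
  induction m with
  | zero => exact contDiffOn_const
  | succ m ih => exact contDiffOn_wedge ih hs

/-- Leibniz: the term where `s` is differentiated is `∂̄s ∧ a = 0`, and the other carries no sign
because `s` has even degree. -/
theorem dbarFlat_wedge {k : ℕ} {s : E → E [⋀^Fin 2]→L[ℝ] ℂ} {a : E → E [⋀^Fin k]→L[ℝ] ℂ} {y : E}
    (hs : DifferentiableAt ℝ s y) (ha : DifferentiableAt ℝ a y) (ht : HasType 2 0 (s y))
    (hd : dbarFlat s y = 0) :
    dbarFlat (fun z => wedge (s z) (a z)) y =
      castDeg (add_assoc 2 k 1).symm (wedge (s y) (dbarFlat a y)) := by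
  let g₁ : E →L[ℝ] E [⋀^Fin (2 + k)]→L[ℝ] ℂ :=
    (wedgeCLM E 2 k (s y)) ∘L antilinearPart (fderiv ℝ a y)
  have h1 : antilinearPart (fderiv ℝ (fun z => wedge (s z) (a z)) y) =
      g₁ + wedgeRight (antilinearPart (fderiv ℝ s y)) (a y) := by
    have h2 := (wedgeCLM E 2 k).fderiv_of_bilinear hs ha
    simp only [wedgeCLM_apply] at h2
    rw [h2]
    ext1 u
    simp only [antilinearPart_apply, g₁, add_apply,
      ContinuousLinearMap.precompR_apply, ContinuousLinearMap.precompL_apply, wedgeCLM_apply,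
      ContinuousLinearMap.compL_apply, ContinuousLinearMap.comp_apply, wedgeRight_apply, wedge_smul, smul_wedge, wedge_add,
      add_wedge]
    module
  rw [dbarFlat, h1, ContinuousAlternatingMap.alternatizeUncurryFin_add,
    alternatizeUncurryFin_wedge ht (antilinearPart (fderiv ℝ a y)) g₁ fun u => rfl]
  have h3 := wedge_alternatizeUncurryFin (antilinearPart (fderiv ℝ s y)) (a y)
    (wedgeRight (antilinearPart (fderiv ℝ s y)) (a y)) fun u => rfl
  rw [show ContinuousAlternatingMap.alternatizeUncurryFin (antilinearPart (fderiv ℝ s y)) = 0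
    from hd] at h3
  have h4 : wedge (0 : E [⋀^Fin (2 + 1)]→L[ℝ] ℂ) (a y) = 0 :=
    LinearMap.map_zero₂ (wedgeBilin E (2 + 1) k) (a y)
  have h5 : ContinuousAlternatingMap.alternatizeUncurryFin
      (wedgeRight (antilinearPart (fderiv ℝ s y)) (a y)) = 0 := by
    have h6 := congrArg (castDeg (by omega : 2 + 1 + k = 2 + k + 1)) (h3.symm.trans h4)
    rwa [castDeg_castDeg, castDeg_rfl] at h6
  rw [h5, add_zero]
  rfl

theorem dbarFlat_wedgePow {k : ℕ} {s : E → E [⋀^Fin 2]→L[ℝ] ℂ} {a : E → E [⋀^Fin k]→L[ℝ] ℂ}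
    {y : E} (hs : DifferentiableAt ℝ s y) (ha : DifferentiableAt ℝ a y) (ht : HasType 2 0 (s y))
    (hd : dbarFlat s y = 0) (m : ℕ) :
    dbarFlat (fun z => wedge (wedgePow (s z) m) (a z)) y =
      castDeg (add_assoc (2 * m) k 1).symm (wedge (wedgePow (s y) m) (dbarFlat a y)) := by
  induction m generalizing k with
  | zero =>
    have h : (fun z => wedge (wedgePow (s z) 0) (a z)) =
        fun z => castDeg (zero_add k).symm (a z) := by
      funext z
      rw [wedge_of_degree_zero]
      simp [wedgePow]
    rw [h, dbarFlat_castDeg, wedge_of_degree_zero, castDeg_castDeg]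
    simp [wedgePow]
  | succ m ih =>
    have h : (fun z => wedge (wedgePow (s z) (m + 1)) (a z)) =
        fun z => castDeg (by omega) (wedge (wedgePow (s z) m) (wedge (s z) (a z))) :=
      funext fun z => wedge_assoc _ _ _
    have h' : wedge (wedgePow (s y) (m + 1)) (dbarFlat a y) =
        castDeg (by omega) (wedge (wedgePow (s y) m) (wedge (s y) (dbarFlat a y))) :=
      wedge_assoc _ _ _
    rw [h, dbarFlat_castDeg, ih (differentiableAt_wedge hs ha), dbarFlat_wedge hs ha ht hd,
      wedge_castDeg, h']
    simp only [castDeg_castDeg]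

end Calculus

/-! ### Smooth dependence of the dual Lefschetz operator -/

section Inverse

variable {E : Type*} [NormedAddCommGroup E] [NormedSpace ℂ E] {U : Set E}

theorem contDiffOn_det {ι : Type*} [Fintype ι] [DecidableEq ι] {A : E → Matrix ι ι ℂ}
    (hA : ∀ i j, ContDiffOn ℝ ∞ (fun z => A z i j) U) :
    ContDiffOn ℝ ∞ (fun z => (A z).det) U := by
  simp only [Matrix.det_apply]
  refine ContDiffOn.sum fun s _ => ?_
  have h : ContDiffOn ℝ ∞ (fun z => ∏ i, A z (s i) i) U := contDiffOn_prod fun i _ => hA _ _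
  simp only [Units.smul_def, zsmul_eq_mul]
  exact contDiffOn_const.mul h

/-- Cramer's rule: the entries are polynomials in those of `A`, divided by the nonvanishing
determinant. -/
theorem contDiffOn_inv {ι : Type*} [Fintype ι] [DecidableEq ι] {A : E → Matrix ι ι ℂ}
    (hA : ∀ i j, ContDiffOn ℝ ∞ (fun z => A z i j) U) (hu : ∀ z ∈ U, IsUnit (A z).det) (i j : ι) :
    ContDiffOn ℝ ∞ (fun z => (A z)⁻¹ i j) U := by
  simp only [Matrix.inv_def, Matrix.smul_apply, Ring.inverse_eq_inv', smul_eq_mul,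
    Matrix.adjugate_apply]
  refine ((contDiffOn_det hA).inv fun z hz => (hu z hz).ne_zero).mul (contDiffOn_det fun i' j' => ?_)
  by_cases h : i' = j
  · simp only [Matrix.updateRow_apply, h, if_true]
    exact contDiffOn_const
  · simp only [Matrix.updateRow_apply, h, if_false]
    exact hA i' j'

theorem contDiffOn_contract (u : E) (k : ℕ) {b : E → E [⋀^Fin (k + 1)]→L[ℝ] ℂ}
    (hb : ContDiffOn ℝ ∞ b U) : ContDiffOn ℝ ∞ (fun z => contract u k (b z)) U :=
  ((ContinuousAlternatingMap.curryLeftLI (𝕜 := ℝ) (E := E) (F := ℂ)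
    (n := k)).toContinuousLinearMap.contDiff.comp_contDiffOn hb).clm_apply contDiffOn_const

theorem contDiffOn_holContractDeg (u : E) (k : ℕ) {b : E → E [⋀^Fin (k + 1)]→L[ℝ] ℂ}
    (hb : ContDiffOn ℝ ∞ b U) : ContDiffOn ℝ ∞ (fun z => holContractDeg u k (b z)) U :=
  ((contDiffOn_contract u k hb).sub
    ((contDiffOn_contract (Complex.I • u) k hb).const_smul Complex.I)).const_smul (1 / 2 : ℂ)

theorem contDiffOn_lowerPow {ι : Type*} [Fintype ι] (e : Module.Basis ι ℂ E)
    {t : E → Matrix ι ι ℂ} (ht : ∀ i j, ContDiffOn ℝ ∞ (fun z => t z i j) U) (k m : ℕ)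
    {b : E → E [⋀^Fin (k + 2 * m)]→L[ℝ] ℂ} (hb : ContDiffOn ℝ ∞ b U) :
    ContDiffOn ℝ ∞ (fun z => lowerPow e (t z) k m (b z)) U := by
  induction m with
  | zero => exact hb
  | succ m ih =>
    have h : ContDiffOn ℝ ∞ (fun z => lower e (t z) (k + 2 * m) (b z)) U := by
      simp only [lower]
      refine ContDiffOn.const_smul _ (ContDiffOn.sum fun i _ => ContDiffOn.sum fun j _ => ?_)
      exact (ht i j).smul (contDiffOn_holContractDeg _ _ (contDiffOn_holContractDeg _ _ hb))
    exact ih h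

end Inverse

/-! ### Forms on the manifold: smoothness, bijectivity, compatibility with `∂̄` -/

section Manifold

variable {E : Type*} [NormedAddCommGroup E] [NormedSpace ℂ E]
variable {X : Type*} [TopologicalSpace X] [ChartedSpace E X] [IsManifold 𝓘(ℂ, E) ω X]

/-- Tangent coordinate changes of a complex manifold are complex-linear, so pull-back preserves
types. -/
theorem hasType_chartRep {p q : ℕ} {α : DForm E X (p + q)} (h : ∀ x, HasType p q (α x)) (x₀ : X)
    (y : E) : HasType p q (chartRep α x₀ y) := fun c v => by
  have h1 := h ((chartAt E x₀).symm y) c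
    (fun i => tangentCoordChange 𝓘(ℂ, E) x₀ ((chartAt E x₀).symm y) ((chartAt E x₀).symm y) (v i))
  rw [← funext fun i => map_smul (tangentCoordChange 𝓘(ℂ, E) x₀ ((chartAt E x₀).symm y)
    ((chartAt E x₀).symm y)) c (v i)] at h1
  exact h1

theorem chartRep_self {k : ℕ} (α : DForm E X k) (x : X) :
    chartRep α x (chartAt E x x) = α x := by
  have h : (chartAt E x).symm (chartAt E x x) = x := (chartAt E x).left_inv (mem_chart_source E x)
  ext v
  simp only [chartRep, ContinuousAlternatingMap.compContinuousLinearMap_apply]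
  rw [h]
  congr 1
  funext i
  exact tangentCoordChange_self (mem_extChartAt_source (I := 𝓘(ℂ, E)) x)

theorem wedgePow_compContinuousLinearMap (s : E [⋀^Fin 2]→L[ℝ] ℂ) (m : ℕ) (A : E →L[ℝ] E) :
    (wedgePow s m).compContinuousLinearMap A = wedgePow (s.compContinuousLinearMap A) m := by
  induction m with
  | zero => rfl
  | succ m ih => exact (wedge_compContinuousLinearMap _ _ _).trans (by rw [ih]; rfl)

theorem chartRep_wedgePowMul (σ : DForm E X 2) (m : ℕ) {k l : ℕ} (h : 2 * m + k = l)
    (α : DForm E X k) (x₀ : X) :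
    chartRep (wedgePowMul σ m h α) x₀ =
      fun y => castDeg h (wedge (wedgePow (chartRep σ x₀ y) m) (chartRep α x₀ y)) := by
  subst h
  funext y
  refine (wedge_compContinuousLinearMap _ _ _).trans ?_
  rw [wedgePow_compContinuousLinearMap]
  rfl

theorem chartRep_nondegenerate {σ : DForm E X 2}
    (hσ : ∀ (x : X) (u : E), (∀ v : E, σ x ![u, v] = 0) → u = 0) (x₀ : X) {y : E}
    (hy : y ∈ (chartAt E x₀).target) (u : E) (hu : ∀ v : E, chartRep σ x₀ y ![u, v] = 0) :
    u = 0 := by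
  set x : X := (chartAt E x₀).symm y with hx
  have hx0 : x ∈ (extChartAt 𝓘(ℂ, E) x₀).source := by
    rw [extChartAt_source]; exact (chartAt E x₀).map_target hy
  have hxx : x ∈ (extChartAt 𝓘(ℂ, E) x).source := mem_extChartAt_source x
  have h1 : ∀ w, tangentCoordChange 𝓘(ℂ, E) x₀ x x (tangentCoordChange 𝓘(ℂ, E) x x₀ x w) = w :=
    fun w => by
      rw [tangentCoordChange_comp ⟨⟨hxx, hx0⟩, hxx⟩, tangentCoordChange_self hxx]
  have h2 : ∀ w, tangentCoordChange 𝓘(ℂ, E) x x₀ x (tangentCoordChange 𝓘(ℂ, E) x₀ x x w) = w :=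
    fun w => by
      rw [tangentCoordChange_comp ⟨⟨hx0, hxx⟩, hx0⟩, tangentCoordChange_self hx0]
  have h3 : tangentCoordChange 𝓘(ℂ, E) x₀ x x u = 0 := by
    refine hσ x _ fun v => ?_
    have h4 := hu (tangentCoordChange 𝓘(ℂ, E) x x₀ x v)
    rw [← h4]
    change _ = σ x _
    congr 1
    funext i
    fin_cases i
    · rfl
    · exact (h1 v).symm
  rw [← h2 u, h3, map_zero]

theorem hasType_dbar {p q : ℕ} {α : DForm E X (p + q)} (hα : α ∈ smoothForms E X p q) (x : X) :
    HasType p (q + 1) (dbar α x) :=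
  hasType_dbarFlat (hα.1.differentiableAt x) (.of_forall (hasType_chartRep hα.2 x))

theorem IsComplexSymplectic.dbarFlat_eq_zero {σ : DForm E X 2} (hσ : IsComplexSymplectic σ)
    (x : X) : dbarFlat (chartRep σ x) (chartAt E x x) = 0 :=
  dbarFlat_eq_zero_of_extDeriv (p := 2) (q := 0) (hσ.mem_smoothForms.1.differentiableAt x)
    (.of_forall (hasType_chartRep hσ.mem_smoothForms.2 x)) (congrFun hσ.closed x)

theorem mem_dbarClosed {p q : ℕ} {α : DForm E X (p + q)} :
    α ∈ dbarClosed E X p q ↔ α ∈ smoothForms E X p q ∧ dbar α = 0 := by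
  constructor
  · rintro ⟨β, hβ, rfl⟩
    exact ⟨β.2, hβ⟩
  · rintro ⟨h, h0⟩
    exact ⟨⟨α, h⟩, h0, rfl⟩

variable [FiniteDimensional ℂ E]

theorem IsSmooth.wedgePowMul {σ : DForm E X 2} (hσ : IsSmooth σ) (m : ℕ) {k l : ℕ}
    (h : 2 * m + k = l) {α : DForm E X k} (hα : IsSmooth α) :
    IsSmooth (wedgePowMul σ m h α) := fun x₀ => by
  rw [chartRep_wedgePowMul]
  exact contDiffOn_castDeg h (contDiffOn_wedge (contDiffOn_wedgePow (hσ x₀) m) (hα x₀))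

theorem IsComplexSymplectic.dbar_wedgePowMul {σ : DForm E X 2} (hσ : IsComplexSymplectic σ)
    (m : ℕ) {k l : ℕ} (h : 2 * m + k = l) (h' : 2 * m + (k + 1) = l + 1) {α : DForm E X k}
    (hα : IsSmooth α) :
    dbar (wedgePowMul σ m h α) = wedgePowMul σ m h' (dbar α) := by
  funext x
  rw [dbar, chartRep_wedgePowMul, dbarFlat_castDeg,
    dbarFlat_wedgePow (hσ.mem_smoothForms.1.differentiableAt x) (hα.differentiableAt x)
      (hasType_chartRep (p := 2) (q := 0) hσ.mem_smoothForms.2 x _) (hσ.dbarFlat_eq_zero x),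
    castDeg_castDeg, chartRep_self]
  rfl

variable {n m : ℕ} {σ : DForm E X 2}

theorem IsComplexSymplectic.wedgePowMul_mem (hσ : IsComplexSymplectic σ) {p q : ℕ}
    (hp : 2 * m + 1 = p) (h : 2 * m + (1 + q) = p + q) {α : DForm E X (1 + q)}
    (hα : α ∈ smoothForms E X 1 q) : wedgePowMul σ m h α ∈ smoothForms E X p q :=
  ⟨hσ.mem_smoothForms.1.wedgePowMul m h hα.1, fun x =>
    HasType.wedgePow_wedge (hσ.mem_smoothForms.2 x) m hp (hα.2 x) h⟩

/-- `K^m` recovers a nonzero multiple of the form at each point. Asking for types but not smoothness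
lets this apply directly to forms `∂̄α`. -/
theorem IsComplexSymplectic.wedgePowMul_injective (hσ : IsComplexSymplectic σ)
    (hdim : Module.finrank ℂ E = 2 * n) (hm : m + 1 = n) {l q : ℕ}
    (h : 2 * m + (1 + q) = l) {α β : DForm E X (1 + q)}
    (hα : ∀ x, HasType 1 q (α x)) (hβ : ∀ x, HasType 1 q (β x))
    (hαβ : wedgePowMul σ m h α = wedgePowMul σ m h β) : α = β := by
  funext x
  have hc : 2 * m + (1 + q) = 1 + q + 2 * m := by omega
  have hn : Fintype.card (Fin (Module.finrank ℂ E)) = 2 * n := by rw [Fintype.card_fin, hdim]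
  have hleft : ∀ {γ : DForm E X (1 + q)}, (∀ x, HasType 1 q (γ x)) →
      lowerPow (Module.finBasis ℂ E) (formMatrix (Module.finBasis ℂ E) (σ x))⁻¹ (1 + q) m
        (castDeg hc (wedge (wedgePow (σ x) m) (γ x))) = lefschetzConst n m • γ x := fun hγ =>
    HasType.lowerPow_wedgePow _ (hσ.mem_smoothForms.2 x) (hσ.nondegenerate x) hn (hγ x) hc
  have h1 : wedge (wedgePow (σ x) m) (α x) = wedge (wedgePow (σ x) m) (β x) := by
    have h2 := congrArg (castDeg h.symm) (congrFun hαβ x)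
    simpa only [wedgePowMul, castDeg_castDeg, castDeg_rfl] using h2
  have h3 := (hleft hα).symm.trans ((congrArg _ (congrArg (castDeg hc) h1)).trans (hleft hβ))
  exact smul_right_injective _ (lefschetzConst_ne_zero hm.le) h3

theorem IsComplexSymplectic.wedgePowMul_surjective (hσ : IsComplexSymplectic σ)
    (hdim : Module.finrank ℂ E = 2 * n) (hm : m + 1 = n) {p q : ℕ} (hp : 2 * m + 1 = p)
    (h : 2 * m + (1 + q) = p + q) {β : DForm E X (p + q)} (hβ : β ∈ smoothForms E X p q) :
    ∃ α ∈ smoothForms E X 1 q, wedgePowMul σ m h α = β := by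
  let e := Module.finBasis ℂ E
  have hn : Fintype.card (Fin (Module.finrank ℂ E)) = 2 * n := by rw [Fintype.card_fin, hdim]
  have hc : p + q = 1 + q + 2 * m := by omega
  have hc' : 2 * m + (1 + q) = 1 + q + 2 * m := by omega
  have hne : lefschetzConst n m ≠ 0 := lefschetzConst_ne_zero hm.le
  -- The preimage forced by `L^m K^m = lefschetzConst n m` on type `(2n-1, q)`.
  let α : DForm E X (1 + q) := fun x => (lefschetzConst n m)⁻¹ •
    lowerPow e (formMatrix e (σ x))⁻¹ (1 + q) m (castDeg hc (β x))
  have htype : ∀ x, HasType 1 q (α x) := fun x =>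
    (hasType_lowerPow e _ (by omega) (hβ.2 x) hc).smul _
  have hmul : wedgePowMul σ m h α = β := by
    funext x
    have h1 := HasType.wedgePow_lowerPow e (hσ.mem_smoothForms.2 x) (hσ.nondegenerate x) (m := m)
      hn (by omega) (hβ.2 x) hc h
    simp only [wedgePowMul, α, wedge_smul, castDeg_smul]
    refine (congrArg ((lefschetzConst n m)⁻¹ • ·) h1).trans ?_
    simp only [smul_smul, inv_mul_cancel₀ hne, one_smul]
  refine ⟨α, ⟨fun x₀ => ?_, htype⟩, hmul⟩
  have hσt : ∀ y, HasType 2 0 (chartRep σ x₀ y) := fun y =>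
    hasType_chartRep (p := 2) (q := 0) hσ.mem_smoothForms.2 x₀ y
  have hnd := fun (y : E) (hy : y ∈ (chartAt E x₀).target) =>
    chartRep_nondegenerate hσ.nondegenerate x₀ hy
  -- `α` is built at each `x` in the preferred chart of `x`. Rather than transforming `K` under
  -- coordinate changes, pull back `σ^m ∧ α = β` to the chart at `x₀` and solve there with `K^m
  -- L^m`; the result depends smoothly on `y`.
  have hrep : ∀ y ∈ (chartAt E x₀).target, chartRep α x₀ y = (lefschetzConst n m)⁻¹ •
      lowerPow e (formMatrix e (chartRep σ x₀ y))⁻¹ (1 + q) m (castDeg hc (chartRep β x₀ y)) :=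
    fun y hy => by
      have h2 := congrFun (chartRep_wedgePowMul σ m h α x₀) y
      rw [hmul] at h2
      have h3 := HasType.lowerPow_wedgePow e (hσt y) (hnd y hy) (m := m) hn
        (hasType_chartRep htype x₀ y) hc'
      rw [h2, castDeg_castDeg, h3, smul_smul, inv_mul_cancel₀ hne, one_smul]
  refine ContDiffOn.congr ?_ hrep
  refine ContDiffOn.const_smul _ (contDiffOn_lowerPow e (contDiffOn_inv (fun i j => ?_)
    fun y hy => (hσt y).isUnit_det_formMatrix e (hnd y hy)) _ _
    (contDiffOn_castDeg hc (hβ.1 x₀)))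
  exact (ContinuousAlternatingMap.apply ℝ E ℂ ![e i, e j]).contDiff.comp_contDiffOn
    (hσ.mem_smoothForms.1 x₀)

/-- `α ↦ σᵐ ∧ α` as a linear map. -/
def wedgePowMulLinear (σ : DForm E X 2) (m : ℕ) {k l : ℕ} (h : 2 * m + k = l) :
    DForm E X k →ₗ[ℂ] DForm E X l where
  toFun := wedgePowMul σ m h
  map_add' α β := funext fun x => by
    simp only [wedgePowMul, DForm.add_apply, wedge_add, castDeg_add]
  map_smul' c α := funext fun x => by
    simp only [wedgePowMul, DForm.smul_apply, wedge_smul, castDeg_smul, RingHom.id_apply]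

/-- Since `∂̄(σ^m ∧ α) = σ^m ∧ ∂̄α`, the converse is injectivity in the next degree `(1, q + 1)`. -/
theorem IsComplexSymplectic.wedgePowMul_mem_dbarClosed (hσ : IsComplexSymplectic σ)
    (hdim : Module.finrank ℂ E = 2 * n) (hm : m + 1 = n) {p q : ℕ} (hp : 2 * m + 1 = p)
    (h : 2 * m + (1 + q) = p + q) {α : DForm E X (1 + q)} (hα : α ∈ smoothForms E X 1 q) :
    wedgePowMul σ m h α ∈ dbarClosed E X p q ↔ α ∈ dbarClosed E X 1 q := by
  have hd := hσ.dbar_wedgePowMul m h (by omega) hα.1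
  rw [mem_dbarClosed, mem_dbarClosed, hd]
  have hzero : wedgePowMul σ m (by omega : 2 * m + (1 + q + 1) = p + q + 1) 0 = 0 :=
    map_zero (wedgePowMulLinear σ m _)
  constructor
  · rintro ⟨-, h0⟩
    refine ⟨hα, ?_⟩
    refine hσ.wedgePowMul_injective hdim hm (q := q + 1) _ (hasType_dbar hα) (fun x c v => ?_)
      (h0.trans hzero.symm)
    exact (mul_zero _).symm
  · rintro ⟨-, h0⟩
    rw [h0]
    exact ⟨hσ.wedgePowMul_mem hp h hα, hzero⟩

/-- A `∂̄`-primitive of `σ^m ∧ α` has the form `σ^m ∧ γ` by surjectivity one degree lower, and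
injectivity turns `σ^m ∧ ∂̄γ = σ^m ∧ α` into `∂̄γ = α`. For `q = 0` only the zero form is exact. -/
theorem IsComplexSymplectic.wedgePowMul_mem_dbarExact (hσ : IsComplexSymplectic σ)
    (hdim : Module.finrank ℂ E = 2 * n) (hm : m + 1 = n) {p q : ℕ} (hp : 2 * m + 1 = p)
    (h : 2 * m + (1 + q) = p + q) {α : DForm E X (1 + q)} (hα : α ∈ smoothForms E X 1 q) :
    wedgePowMul σ m h α ∈ dbarExact E X p q ↔ α ∈ dbarExact E X 1 q := by
  cases q with
  | zero =>
    have hzero : wedgePowMul σ m h 0 = 0 := map_zero (wedgePowMulLinear σ m h)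
    constructor
    · intro h0
      refine (Submodule.mem_bot ℂ).2 (hσ.wedgePowMul_injective hdim hm h hα.2 (fun x c v => ?_)
        (((Submodule.mem_bot ℂ).1 h0).trans hzero.symm))
      exact (mul_zero _).symm
    · intro h0
      rw [(Submodule.mem_bot ℂ).1 h0]
      exact (Submodule.mem_bot ℂ).2 hzero
  | succ q =>
    have h' : 2 * m + (1 + q) = p + q := by omega
    constructor
    · rintro ⟨δ, hδ⟩
      obtain ⟨γ, hγ, hγδ⟩ := hσ.wedgePowMul_surjective hdim hm hp h' δ.2
      refine ⟨⟨γ, hγ⟩, ?_⟩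
      refine hσ.wedgePowMul_injective hdim hm h (hasType_dbar hγ) hα.2 ?_
      refine Eq.trans ?_ hδ
      change _ = dbar δ.1
      rw [← hγδ]
      exact (hσ.dbar_wedgePowMul m h' h hγ.1).symm
    · rintro ⟨γ, rfl⟩
      refine ⟨⟨_, hσ.wedgePowMul_mem hp h' γ.2⟩, ?_⟩
      exact hσ.dbar_wedgePowMul m h' h γ.2.1

end Manifold

end ComplexForms

end
-- Passage to Dolbeault cohomology
open ComplexForms in
theorem corollary2p3 {E : Type*} [NormedAddCommGroup E] [NormedSpace ℂ E] [FiniteDimensional ℂ E]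
    {X : Type*} [TopologicalSpace X] [T2Space X] [CompactSpace X] [ConnectedSpace X]
    [ChartedSpace E X] [IsManifold 𝓘(ℂ, E) ω X]
    (n : ℕ) (hn : 1 ≤ n) (hdim : Module.finrank ℂ E = 2 * n)
    (σ : DForm E X 2) (hσ : IsComplexSymplectic σ) (q : ℕ) :
    ∃ Φ : Dolbeault E X 1 q ≃ₗ[ℂ] Dolbeault E X (2 * n - 1) q,
      ∀ α : dbarClosed E X 1 q,
        ∃ hα : wedgePowMul σ (n - 1) (by omega) α.1 ∈ dbarClosed E X (2 * n - 1) q,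
          Φ (dolbeaultClass α) = dolbeaultClass ⟨_, hα⟩ := by
  have hm : n - 1 + 1 = n := by omega
  have hp : 2 * (n - 1) + 1 = 2 * n - 1 := by omega
  have h : 2 * (n - 1) + (1 + q) = 2 * n - 1 + q := by omega
  have hclosed : ∀ α ∈ dbarClosed E X 1 q,
      wedgePowMulLinear σ (n - 1) h α ∈ dbarClosed E X (2 * n - 1) q := fun α hα =>
    (hσ.wedgePowMul_mem_dbarClosed hdim hm hp h (mem_dbarClosed.1 hα).1).2 hα
  let T := (wedgePowMulLinear σ (n - 1) h).restrict hclosed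
  have hT : Function.Bijective T := by
    constructor
    · intro α β hαβ
      exact Subtype.ext (hσ.wedgePowMul_injective hdim hm h (mem_dbarClosed.1 α.2).1.2
        (mem_dbarClosed.1 β.2).1.2 (congrArg Subtype.val hαβ))
    · rintro ⟨β, hβ⟩
      obtain ⟨α, hα, rfl⟩ := hσ.wedgePowMul_surjective hdim hm hp h (mem_dbarClosed.1 hβ).1
      exact ⟨⟨α, (hσ.wedgePowMul_mem_dbarClosed hdim hm hp h hα).1 hβ⟩, rfl⟩
  let T' := LinearEquiv.ofBijective T hT
  -- Equality, not just inclusion, is what makes the induced map on quotients injective as well as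
  -- well defined.
  have hexact : ((dbarExact E X 1 q).submoduleOf (dbarClosed E X 1 q)).map
      (T' : dbarClosed E X 1 q →ₗ[ℂ] dbarClosed E X (2 * n - 1) q) =
      (dbarExact E X (2 * n - 1) q).submoduleOf (dbarClosed E X (2 * n - 1) q) := by
    ext β
    obtain ⟨α, rfl⟩ := hT.2 β
    have h1 := hσ.wedgePowMul_mem_dbarExact hdim hm hp h (mem_dbarClosed.1 α.2).1
    constructor
    · rintro ⟨α', hα', he⟩
      rw [← hT.1 he]
      exact (hσ.wedgePowMul_mem_dbarExact hdim hm hp h (mem_dbarClosed.1 α'.2).1).2 hα'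
    · intro hβ
      exact ⟨α, h1.1 hβ, rfl⟩
  refine ⟨Submodule.Quotient.equiv _ _ T' hexact, fun α => ⟨hclosed α.1 α.2, rfl⟩⟩
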